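/- All graphs are finite, and classes of graphs are closed under isomorphism. A block of a graph is a maximal 2-connected subgraph (on at least three vertices), or the subgraph formed by a bridge or by an isolated vertex. For connected graphs $G,H$ write $G\sim H$ if they have the same vertex set and the same number of blocks of each isomorphism type; for general graphs write $G\sim H$ if their components can be listed as $G_1,\dots,G_j$ and $H_1,\dots,H_j$ with $G_i\sim H_i$ for each $i$. A class $\mathcal A$ is weakly block-stable if $G\in\mathcal A$ and $H\sim G$ imply $H\in\mathcal A$. The block-degree $\widetilde d_G(v)$ is the number of blocks of $G$ containing $v$, and $\widetilde\Delta(G)=\max_v\widetilde d_G(v)$. $\mathcal A_n$ is the set of graphs in $\mathcal A$ on vertex set $[n]=\{1,\dots,n\}$; only integers $n$ for which the set sampled from is non-empty are considered, and limits as $n\to\infty$ are taken along such $n$. An event holds whp if its probability tends to $1$ as $n\to\infty$. A random vector $X$ is stochastically at most $Y$ if $\mathbb E f(X)\le\mathbb E f(Y)$ for every non-decreasing integrable $f:\mathbb R^n\to\mathbb R$; a real random variable $X$ is stochastically at most $Y$ if $\mathbb P(X\ge t)\le\mathbb P(Y\ge t)$ for all real $t$. **Theorem 1.** Let $\mathcal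 A$ be a weakly block-stable class of graphs and let $\mathcal C$ be the class of connected graphs in $\mathcal A$. (a) Let $n\ge 2$, let $R_n$ be uniform on $\mathcal C_n$ and let $T_n$ be a uniformly random tree on $[n]$. Then $(\widetilde d_{R_n}(v):v\in[n])$ is stochastically at most the degree sequence $(d_{T_n}(v):v\in[n])$; and in particular $\widetilde\Delta(R_n)$ is stochastically at most the maximum degree $\Delta(T_n)$. (b) Let $R_n$ be uniform on $\mathcal A_n$, and let $\varepsilon(x)=2\log\log\log x/\log\log x$ and $\eta(x)=2\log\log x/\log x$, both of which tend to $0$ as $x\to\infty$. Then $$\widetilde\Delta(R_n)\le(1+\varepsilon(n))\frac{\log n}{\log\log n}\quad\text{whp.}$$ For each constant $c>0$ there is $N=N(c)$, not depending on $\mathcal A$, such that for all $n\ge N$ $$\mathbb P\big(\widetilde\Delta(R_n)\ge cn/\log n\big)\le e^{-(1-\eta(n))cn}.$$ Further, if each graph in $\mathcal A_n$ has at most $k=k(n)$ blocks, where $k(n)\to\infty$ as $n\to\infty$, then $$\widetilde\Delta(R_n)\le(1+\varepsilon(k))\frac{\log k}{\log\log k}\quad\text{whp.}$$ -/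

import Mathlib

open Filter Topology

namespace SimpleGraph

variable {V W : Type}

/-- 2-connected: at least three vertices, connected, and no vertex deletion disconnects. -/
def IsTwoConnected (G : SimpleGraph V) : Prop :=
  3 ≤ Nat.card V ∧ G.Connected ∧ ∀ v : V, (G.induce {v}ᶜ).Connected

/-- A block of `G`: a maximal 2-connected subgraph, or the subgraph formed by a bridge
or by an isolated vertex. -/
def IsBlock (G : SimpleGraph V) (B : G.Subgraph) : Prop :=
  Maximal (fun B' : G.Subgraph => B'.coe.IsTwoConnected) B ∨
  (∃ (u v : V) (h : G.Adj u v), G.IsBridge s(u, v) ∧ B = G.subgraphOfAdj h) ∨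
  (∃ v : V, G.IsIsolated v ∧ B = G.singletonSubgraph v)

/-- The total number of blocks of `G`. -/
noncomputable def numBlocks (G : SimpleGraph V) : ℕ := {B : G.Subgraph | G.IsBlock B}.ncard

/-- The block-degree of `v`: the number of blocks of `G` containing `v`. -/
noncomputable def blockDegree (G : SimpleGraph V) (v : V) : ℕ :=
  {B : G.Subgraph | G.IsBlock B ∧ v ∈ B.verts}.ncard

/-- The maximum block-degree. -/
noncomputable def maxBlockDegree [Fintype V] (G : SimpleGraph V) : ℕ :=
  Finset.univ.sup G.blockDegree

/-- `G` and `H` have the same number of blocks of each isomorphism type, expressed as a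
bijection between the blocks that matches isomorphic blocks. -/
def SameBlocks (G : SimpleGraph V) (H : SimpleGraph W) : Prop :=
  ∃ e : {B : G.Subgraph // G.IsBlock B} ≃ {B : H.Subgraph // H.IsBlock B},
    ∀ B, Nonempty (B.1.coe ≃g (e B).1.coe)

/-- `G ∼ H`: the components of `G` and `H` can be matched so that matched components have
the same vertex set and the same number of blocks of each kind. -/
def BlockEquiv (G H : SimpleGraph V) : Prop :=
  ∃ e : G.ConnectedComponent ≃ H.ConnectedComponent,
    ∀ c, (e c).supp = c.supp ∧ SameBlocks c.toSimpleGraph (e c).toSimpleGraph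

open Classical in
/-- The degree sequence, as a real vector. -/
noncomputable def degreeSeq [Fintype V] (G : SimpleGraph V) : V → ℝ := fun v => (G.degree v : ℝ)

/-- The sequence of block-degrees, as a real vector. -/
noncomputable def blockDegreeSeq (G : SimpleGraph V) : V → ℝ := fun v => (G.blockDegree v : ℝ)

open Classical in
/-- The maximum degree, as a real number. -/
noncomputable def maxDegreeReal [Fintype V] (G : SimpleGraph V) : ℝ := (G.maxDegree : ℝ)

end SimpleGraph

/-- A class of finite graphs, closed under isomorphism. -/
structure GraphClass where
  Mem : ∀ {V : Type} [Finite V], SimpleGraph V → Prop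
  iso_closed : ∀ {V W : Type} [Finite V] [Finite W] {G : SimpleGraph V} {H : SimpleGraph W},
    Nonempty (G ≃g H) → Mem G → Mem H

namespace GraphClass

/-- Membership in a weakly block-stable class is preserved by the relation `∼`. -/
def IsWeaklyBlockStable (A : GraphClass) : Prop :=
  ∀ {V : Type} [Finite V] (G H : SimpleGraph V), A.Mem G → G.BlockEquiv H → A.Mem H

/-- The class of connected graphs in `A`. -/
def connectedPart (A : GraphClass) : GraphClass where
  Mem G := A.Mem G ∧ G.Connected
  iso_closed := fun ⟨e⟩ h => ⟨A.iso_closed ⟨e⟩ h.1, e.connected_iff.1 h.2⟩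

/-- The graphs in `A` on an `n`-element labelled vertex set. -/
def on (A : GraphClass) (n : ℕ) : Set (SimpleGraph (Fin n)) := {G | A.Mem G}

/-- `n → ∞` through those `n` for which `A` contains a graph on `n` vertices. -/
def sizes (A : GraphClass) : Filter ℕ := atTop ⊓ 𝓟 {n | (A.on n).Nonempty}

end GraphClass

/-- The (labelled) trees on `n` vertices. -/
def treesOn (n : ℕ) : Set (SimpleGraph (Fin n)) := {T | T.IsTree}

/-- Probability of the event `E` for a uniformly random element of the finite nonempty set `S`. -/
noncomputable def unifProb {α : Type} (S : Set α) (E : α → Prop) : ℝ :=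
  ({x ∈ S | E x}.ncard : ℝ) / (S.ncard : ℝ)

/-- Expectation of `f` at a uniformly random element of the finite nonempty set `S`. -/
noncomputable def unifExp {α : Type} (S : Set α) (f : α → ℝ) : ℝ :=
  (∑ᶠ x ∈ S, f x) / (S.ncard : ℝ)

/-- The real random variable `X` of a uniform element of `S` is stochastically at most the real
random variable `Y` of a uniform element of `T`. -/
def StochLE {α β : Type} (S : Set α) (X : α → ℝ) (T : Set β) (Y : β → ℝ) : Prop :=
  ∀ t : ℝ, unifProb S (fun x => t ≤ X x) ≤ unifProb T (fun y => t ≤ Y y)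

/-- The same for random vectors, through expectations of all non-decreasing functions (which are
all integrable here, since the random vectors take finitely many values). -/
def StochLEVec {α β ι : Type} (S : Set α) (X : α → ι → ℝ) (T : Set β) (Y : β → ι → ℝ) : Prop :=
  ∀ f : (ι → ℝ) → ℝ, Monotone f → unifExp S (fun x => f (X x)) ≤ unifExp T (fun y => f (Y y))

/-- `ε(x) = 2 log log log x / log log x`. -/
noncomputable def epsFn (x : ℝ) : ℝ :=
  2 * Real.log (Real.log (Real.log x)) / Real.log (Real.log x)

/-- `η(x) = 2 log log x / log x`. -/
noncomputable def etaFn (x : ℝ) : ℝ := 2 * Real.log (Real.log x) / Real.log x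

/-- `(1 + ε(x)) log x / log log x`. -/
noncomputable def degreeBound (x : ℝ) : ℝ :=
  (1 + epsFn x) * Real.log x / Real.log (Real.log x)

/-!
# Block-degrees in weakly block-stable classes

The proof rests on one operation on graphs. If `C` is a branch of `G` at `u`, that is, a component
of `G - u` with a neighbour of `u`, and `v ∉ C` is another vertex of the component of `u`, then `C`
can be detached from `u` and attached to `v` (`SimpleGraph.moveBranch`). This keeps the
components and the isomorphism types of their blocks, so the new graph is `∼`-equivalent to `G`
(`blockEquiv_moveBranch`); it lowers the block-degree of `u` by one, raises that of `v` by one and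
changes no other. The operation is undone by moving `C` back from `v` to `u`.

A vertex `u` has as many branches as blocks, and exactly one of them leads to `v`
(`ncard_branches_avoiding`). Let `N(d)` be the number of graphs of the class with a given component
`W` in which each vertex `x` of `W` has block-degree `d x + 1`. Double counting the pairs of a graph
and a branch to be moved gives `(d u + 1) N(d + δ_u) = (d v + 1) N(d + δ_v)`
(`exchangeRel_excess`). With the sum `m` of the entries fixed, this relation determines `N` up to a
factor, and the numbers of words of length `m` over the alphabet `W` with given letter counts
satisfy it too. Hence, given `m`, the excess block-degrees on `W` are distributed as the letter
counts of a uniform word of length `m` (`ExchangeRel.sum_eq`).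

For a connected graph on `n ≥ 2` vertices `m ≤ n - 2`, with equality for trees, whose blocks are
their edges. As longer words have larger letter counts, this gives the comparison with the degrees
of a random tree (`stochLEVec_blockDegreeSeq`).

For general graphs, a given letter occurs at least `t` times in a word of length `m ≤ |W|` with
probability at most `m ^ t / (t! |W| ^ t)`, so the expected number of vertices of `W` with
block-degree above `t` is at most `m / t!` when `t ≥ 1`. Both the number of blocks and the number of
vertices bound the sum of `m` over the components, whence `P(max block-degree > t) ≤ K / t!`
whenever all graphs have at most `K` vertices or at most `K` blocks
(`unifProb_lt_maxBlockDegree_le`). The asymptotic statements follow from lower bounds for `t!`.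

Blocks are handled through their vertex sets, the maximal nonseparable sets (`isBlock_iff`), and
connectedness through cuts, so that no paths or cycles have to be manipulated.
-/

/-! ### Connected and nonseparable vertex sets -/

namespace SimpleGraph

section BlockSets

variable {V W : Type}

/-- The set `S` induces a preconnected subgraph of `G`, in cut form: a set that meets `S` and that
no edge of `G[S]` leaves contains `S`. The empty set qualifies. -/
def ConnOn (G : SimpleGraph V) (S : Set V) : Prop :=
  ∀ K : Set V, ∀ a ∈ S, a ∈ K → (∀ x ∈ S, x ∈ K → ∀ y ∈ S, G.Adj x y → y ∈ K) → S ⊆ K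

/-- The set `S` induces a connected subgraph without cut vertex: a single vertex, an edge, or a
2-connected graph. -/
def IsNonsep (G : SimpleGraph V) (S : Set V) : Prop :=
  S.Nonempty ∧ G.ConnOn S ∧ ∀ x, G.ConnOn (S \ {x})

/-- The vertex sets of the blocks of `G`: the maximal nonseparable sets. -/
def blockSets (G : SimpleGraph V) : Set (Set V) := {S | Maximal G.IsNonsep S}

/-- `C` is a branch of `G` at `u`: a connected component of `G - u` with a neighbour of `u`. -/
def IsBranch (G : SimpleGraph V) (u : V) (C : Set V) : Prop :=
  u ∉ C ∧ G.ConnOn C ∧ (∀ a ∈ C, ∀ b, G.Adj a b → b ∈ C ∨ b = u) ∧ ∃ c ∈ C, G.Adj u c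

/-- The component of `w` in `G - u`, as the union of the connected sets that contain `w` and avoid
`u`; it is empty for `w = u`. -/
def compOff (G : SimpleGraph V) (u w : V) : Set V :=
  {x | ∃ D, G.ConnOn D ∧ u ∉ D ∧ w ∈ D ∧ x ∈ D}

variable {G : SimpleGraph V} {H : SimpleGraph W}

lemma connOn_singleton (v : V) : G.ConnOn {v} := by
  intro K a ha haK _ x hx
  simp only [Set.mem_singleton_iff] at ha hx
  rwa [hx, ← ha]

lemma connOn_of_subsingleton {S : Set V} (hS : S.Subsingleton) : G.ConnOn S :=
  fun _ _ ha haK _ _ hx => hS ha hx ▸ haK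

lemma ConnOn.union {S T : Set V} (hS : G.ConnOn S) (hT : G.ConnOn T) {z : V} (hzS : z ∈ S)
    (hzT : z ∈ T) : G.ConnOn (S ∪ T) := by
  intro K a ha haK hK
  have hS' : ∀ b ∈ S, b ∈ K → S ⊆ K := fun b hb hbK =>
    hS K b hb hbK fun x hx hxK y hy hxy => hK x (Or.inl hx) hxK y (Or.inl hy) hxy
  have hT' : ∀ b ∈ T, b ∈ K → T ⊆ K := fun b hb hbK =>
    hT K b hb hbK fun x hx hxK y hy hxy => hK x (Or.inr hx) hxK y (Or.inr hy) hxy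
  rcases ha with ha | ha
  · exact Set.union_subset (hS' a ha haK) (hT' z hzT (hS' a ha haK hzS))
  · exact Set.union_subset (hS' z hzS (hT' a ha haK hzT)) (hT' a ha haK)

lemma ConnOn.insert_adj {S : Set V} (hS : G.ConnOn S) {z y : V} (hz : z ∈ S) (hzy : G.Adj z y) :
    G.ConnOn (insert y S) := by
  intro K a ha haK hK
  have hS' : ∀ b ∈ S, b ∈ K → S ⊆ K := fun b hb hbK =>
    hS K b hb hbK fun x hx hxK y hy hxy => hK x (Or.inr hx) hxK y (Or.inr hy) hxy
  have h1 : ∀ x ∈ S, x ∈ K → insert y S ⊆ K := fun x hx hxK =>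
    Set.insert_subset (hK z (Or.inr hz) (hS' x hx hxK hz) y (Or.inl rfl) hzy) (hS' x hx hxK)
  rcases ha with rfl | ha
  · exact h1 z hz (hK a (Or.inl rfl) haK z (Or.inr hz) hzy.symm)
  · exact h1 a ha haK

lemma ConnOn.exists_adj {S : Set V} (hS : G.ConnOn S) {v w : V} (hv : v ∈ S) (hw : w ∈ S)
    (h : v ≠ w) : ∃ x ∈ S, G.Adj v x := by
  by_contra! hcon
  have := hS {v} v hv rfl (fun x hx hxv y hy hxy => by
    rw [Set.mem_singleton_iff] at hxv; subst hxv; exact absurd hxy (hcon y hy))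
  exact h (this hw).symm

lemma ConnOn.image {S : Set V} (hS : G.ConnOn S) (f : V → W)
    (hf : ∀ a ∈ S, ∀ b ∈ S, G.Adj a b → H.Adj (f a) (f b)) : H.ConnOn (f '' S) := by
  rintro K _ ⟨a, ha, rfl⟩ haK hK
  rw [Set.image_subset_iff]
  exact hS (f ⁻¹' K) a ha haK fun x hx hxK y hy hxy =>
    hK (f x) ⟨x, hx, rfl⟩ hxK (f y) ⟨y, hy, rfl⟩ (hf x hx y hy hxy)

lemma IsNonsep.image {S : Set V} (hS : G.IsNonsep S) (f : V → W) (hinj : Set.InjOn f S)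
    (hf : ∀ a ∈ S, ∀ b ∈ S, G.Adj a b → H.Adj (f a) (f b)) : H.IsNonsep (f '' S) := by
  refine ⟨hS.1.image f, hS.2.1.image f hf, fun y => ?_⟩
  by_cases hy : y ∈ f '' S
  · obtain ⟨x, hx, rfl⟩ := hy
    have : f '' S \ {f x} = f '' (S \ {x}) := by
      ext z
      constructor
      · rintro ⟨⟨s, hs, rfl⟩, hne⟩
        exact ⟨s, ⟨hs, fun h => hne (by rw [Set.mem_singleton_iff.1 h]; rfl)⟩, rfl⟩
      · rintro ⟨s, ⟨hs, hne⟩, rfl⟩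
        exact ⟨⟨s, hs, rfl⟩, fun h => hne (hinj hs hx h)⟩
    rw [this]
    exact (hS.2.2 x).image f fun a ha b hb => hf a ha.1 b hb.1
  · rw [Set.sdiff_singleton_eq_self hy]
    exact hS.2.1.image f hf

lemma isNonsep_singleton (v : V) : G.IsNonsep {v} :=
  ⟨⟨v, rfl⟩, connOn_singleton v, fun _ =>
    connOn_of_subsingleton (Set.subsingleton_singleton.anti Set.sdiff_subset)⟩

lemma isNonsep_pair {u v : V} (h : G.Adj u v) : G.IsNonsep {u, v} := by
  refine ⟨⟨u, Or.inl rfl⟩, (connOn_singleton v).insert_adj rfl h.symm, fun x => ?_⟩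
  by_cases hx : x = u ∨ x = v
  · refine connOn_of_subsingleton ?_
    rintro a ⟨ha, hax⟩ b ⟨hb, hbx⟩
    simp only [Set.mem_insert_iff, Set.mem_singleton_iff] at ha hb hax hbx
    grind
  · rw [Set.sdiff_singleton_eq_self (by simpa using hx)]
    exact (connOn_singleton v).insert_adj rfl h.symm

/-- Nonseparable sets sharing two vertices have a nonseparable union. -/
lemma IsNonsep.union {S T : Set V} (hS : G.IsNonsep S) (hT : G.IsNonsep T) {a b : V}
    (hab : a ≠ b) (ha : a ∈ S ∩ T) (hb : b ∈ S ∩ T) : G.IsNonsep (S ∪ T) := by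
  refine ⟨hS.1.mono Set.subset_union_left, hS.2.1.union hT.2.1 ha.1 ha.2, fun x => ?_⟩
  rw [Set.union_sdiff_distrib]
  by_cases hx : x = a
  · exact (hS.2.2 x).union (hT.2.2 x) (z := b) ⟨hb.1, fun h => hab (hx ▸ h.symm)⟩
      ⟨hb.2, fun h => hab (hx ▸ h.symm)⟩
  · exact (hS.2.2 x).union (hT.2.2 x) (z := a) ⟨ha.1, fun h => hx h.symm⟩
      ⟨ha.2, fun h => hx h.symm⟩

lemma blockSets_eq_of_two_mem {S T : Set V} (hS : S ∈ G.blockSets) (hT : T ∈ G.blockSets) {a b : V}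
    (hab : a ≠ b) (ha : a ∈ S ∩ T) (hb : b ∈ S ∩ T) : S = T := by
  have h := hS.1.union hT.1 hab ha hb
  exact (hS.eq_of_subset h Set.subset_union_left).trans
    (hT.eq_of_subset h Set.subset_union_right).symm

lemma IsNonsep.exists_blockSet [Finite V] {S : Set V} (hS : G.IsNonsep S) :
    ∃ B ∈ G.blockSets, S ⊆ B := by
  obtain ⟨B, hSB, hB⟩ := Finite.exists_le_maximal hS
  exact ⟨B, hB, hSB⟩

/-- A nonseparable set is not separated by a single vertex `u`. -/
lemma IsNonsep.subset_insert {S C : Set V} {u : V} (hS : G.IsNonsep S) (hu : u ∉ C)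
    (hC : ∀ a ∈ C, ∀ b, G.Adj a b → b ∈ C ∨ b = u) (hSC : (S ∩ C).Nonempty) :
    S ⊆ insert u C := by
  obtain ⟨c, hcS, hcC⟩ := hSC
  have := hS.2.2 u C c ⟨hcS, fun h => hu (h ▸ hcC)⟩ hcC
    (fun x _ hxC y hy hxy => (hC x hxC y hxy).resolve_right hy.2)
  intro x hx
  by_cases hxu : x = u
  · exact Or.inl hxu
  · exact Or.inr (this ⟨hx, hxu⟩)

/-- Two neighbours of `u` that are connected in `G - u` lie on a cycle through `u`, whose vertex set
is nonseparable. Instead of a cycle, a minimal connected set joining them is used. -/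
lemma exists_isNonsep_of_connOn [Finite V] {D₀ : Set V} {u w w' : V} (hD₀ : G.ConnOn D₀)
    (hu₀ : u ∉ D₀) (hw₀ : w ∈ D₀) (hw'₀ : w' ∈ D₀) (huw : G.Adj u w) (huw' : G.Adj u w') :
    ∃ S, G.IsNonsep S ∧ u ∈ S ∧ w ∈ S ∧ w' ∈ S := by
  obtain ⟨D, -, ⟨hD, hu, hw, hw'⟩, hmin⟩ := Finite.exists_le_minimal
    (p := fun D : Set V => G.ConnOn D ∧ u ∉ D ∧ w ∈ D ∧ w' ∈ D) ⟨hD₀, hu₀, hw₀, hw'₀⟩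
  refine ⟨insert u D, ⟨⟨u, Or.inl rfl⟩, hD.insert_adj hw huw.symm, fun x => ?_⟩, Or.inl rfl,
    Or.inr hw, Or.inr hw'⟩
  by_cases hxu : x = u
  · subst hxu
    rwa [Set.insert_sdiff_self_of_notMem hu]
  -- a set `K` closed in `D ∪ {u}` minus `x` that avoids `u` could be cut off from `D`
  have key : ∀ K : Set V, K ⊆ D \ {x} → u ∉ K →
      (∀ a ∈ K, ∀ b ∈ insert u D, b ≠ x → G.Adj a b → b ∈ K) → K = ∅ := by
    intro K hKD huK hK
    have hwK : ∀ y, G.Adj u y → y ∉ K := fun y hy hyK =>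
      huK (hK y hyK u (Or.inl rfl) (Ne.symm hxu) hy.symm)
    have hconn : G.ConnOn (D \ K) := by
      intro L a ha haL hL
      by_cases hxL : x ∈ L
      · have h1 := hD (L ∪ K) a ha.1 (Or.inl haL) (by
          rintro p hp (hpL | hpK) q hq hpq
          · by_cases hqK : q ∈ K
            · exact Or.inr hqK
            · by_cases hpK : p ∈ K
              · by_cases hqx : q = x
                · exact Or.inl (hqx ▸ hxL)
                · exact Or.inr (hK p hpK q (Or.inr hq) hqx hpq)
              · exact Or.inl (hL p ⟨hp, hpK⟩ hpL q ⟨hq, hqK⟩ hpq)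
          · by_cases hqx : q = x
            · exact Or.inl (hqx ▸ hxL)
            · exact Or.inr (hK p hpK q (Or.inr hq) hqx hpq))
        exact fun y hy => (h1 hy.1).resolve_right hy.2
      · have h1 := hD (L \ K) a ha.1 ⟨haL, ha.2⟩ (by
          rintro p hp ⟨hpL, hpK⟩ q hq hpq
          have hqK : q ∉ K := fun hqK => by
            by_cases hpx : p = x
            · exact hxL (hpx ▸ hpL)
            · exact hpK (hK q hqK p (Or.inr hp) hpx hpq.symm)
          exact ⟨hL p ⟨hp, hpK⟩ hpL q ⟨hq, hqK⟩ hpq, hqK⟩)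
        exact fun y hy => (h1 hy.1).1
    have hle := hmin ⟨hconn, fun h => hu h.1, ⟨hw, hwK w huw⟩, ⟨hw', hwK w' huw'⟩⟩
      Set.sdiff_subset
    ext y
    simp only [Set.mem_empty_iff_false, iff_false]
    exact fun hy => (hle (hKD hy).1).2 hy
  intro K a ha haK hK
  by_cases huK : u ∈ K
  · have := key ((D \ {x}) \ K) Set.sdiff_subset (fun h => h.2 huK) (by
      rintro p ⟨⟨hp, hpx⟩, hpK⟩ q hq hqx hpq
      have hqK : q ∉ K := fun hqK => hpK (hK q ⟨hq, hqx⟩ hqK p ⟨Or.inr hp, hpx⟩ hpq.symm)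
      have hqu : q ≠ u := fun h => hqK (h ▸ huK)
      exact ⟨⟨hq.resolve_left hqu, hqx⟩, hqK⟩)
    rintro y ⟨rfl | hyD, hyx⟩
    · exact huK
    · by_contra hyK
      exact (this ▸ (⟨⟨hyD, hyx⟩, hyK⟩ : y ∈ (D \ {x}) \ K) : y ∈ (∅ : Set V))
  · have := key ((D \ {x}) ∩ K) Set.inter_subset_left (fun h => huK h.2) (by
      rintro p ⟨⟨hp, hpx⟩, hpK⟩ q hq hqx hpq
      have hqK : q ∈ K := hK p ⟨Or.inr hp, hpx⟩ hpK q ⟨hq, hqx⟩ hpq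
      have hqu : q ≠ u := fun h => huK (h ▸ hqK)
      exact ⟨⟨hq.resolve_left hqu, hqx⟩, hqK⟩)
    have hau : a ≠ u := fun h => huK (h ▸ haK)
    exact ((this ▸ (⟨⟨ha.1.resolve_left hau, ha.2⟩, haK⟩ : a ∈ (D \ {x}) ∩ K)) :
      a ∈ (∅ : Set V)).elim

/-! ### Branches at a vertex and the blocks containing it -/

lemma notMem_compOff (u w : V) : u ∉ G.compOff u w := fun ⟨_, _, hu, _, h⟩ => hu h

lemma mem_compOff {u w : V} (h : u ≠ w) : w ∈ G.compOff u w :=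
  ⟨{w}, connOn_singleton w, h, rfl, rfl⟩

lemma connOn_compOff (u w : V) : G.ConnOn (G.compOff u w) := by
  have key : ∀ K : Set V, ∀ a ∈ G.compOff u w, a ∈ K →
      (∀ x ∈ G.compOff u w, x ∈ K → ∀ y ∈ G.compOff u w, G.Adj x y → y ∈ K) →
      ∀ D, G.ConnOn D → u ∉ D → w ∈ D → ∀ b ∈ D, b ∈ K → D ⊆ K := by
    intro K a ha haK hK D hD hu hw b hb hbK
    exact hD K b hb hbK fun x hx hxK y hy hxy =>
      hK x ⟨D, hD, hu, hw, hx⟩ hxK y ⟨D, hD, hu, hw, hy⟩ hxy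
  intro K a ha haK hK
  have ha' := ha
  obtain ⟨D, hD, huD, hwD, haD⟩ := ha'
  have hwK := key K a ha haK hK D hD huD hwD a haD haK hwD
  rintro y ⟨D', hD', huD', hwD', hyD'⟩
  exact key K a ha haK hK D' hD' huD' hwD' w hwD' hwK hyD'

lemma compOff_closed {u w : V} :
    ∀ a ∈ G.compOff u w, ∀ b, G.Adj a b → b ∈ G.compOff u w ∨ b = u := by
  rintro a ⟨D, hD, hu, hw, ha⟩ b hab
  by_cases hb : b = u
  · exact Or.inr hb
  · refine Or.inl ⟨insert b D, hD.insert_adj ha hab, ?_, Or.inr hw, Or.inl rfl⟩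
    rintro (h | h)
    · exact hb h.symm
    · exact hu h

lemma isBranch_compOff {u w : V} (h : G.Adj u w) : G.IsBranch u (G.compOff u w) :=
  ⟨notMem_compOff u w, connOn_compOff u w, compOff_closed, w, mem_compOff h.ne, h⟩

lemma IsBranch.eq_of_mem {u x : V} {C C' : Set V} (hC : G.IsBranch u C) (hC' : G.IsBranch u C')
    (hx : x ∈ C) (hx' : x ∈ C') : C = C' := by
  have key : ∀ {C C' : Set V}, G.IsBranch u C → G.IsBranch u C' → x ∈ C → x ∈ C' → C ⊆ C' :=
    fun {C C'} hC hC' hx hx' => hC.2.1 C' x hx hx' fun p _ hp' q hq hpq =>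
      (hC'.2.2.1 p hp' q hpq).resolve_right fun h => hC.1 (h ▸ hq)
  exact (key hC hC' hx hx').antisymm (key hC' hC hx' hx)

/-- A set that no edge leaves is closed under reachability. -/
lemma Reachable.mem_of_closed {K : Set V} {u v : V} (h : G.Reachable u v)
    (hK : ∀ a ∈ K, ∀ b, G.Adj a b → b ∈ K) (hu : u ∈ K) : v ∈ K := by
  obtain ⟨p⟩ := h
  by_contra hv
  obtain ⟨d, -, h1, h2⟩ := p.exists_boundary_dart K hu hv
  exact h2 (hK _ h1 _ d.adj)

lemma connOn_reachable {S : Set V} (hS : G.ConnOn S) {a b : V} (ha : a ∈ S) (hb : b ∈ S) :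
    G.Reachable a b :=
  hS {x | G.Reachable a x} a ha (Reachable.refl a)
    (fun _ _ hx _ _ hxy => Reachable.trans hx hxy.reachable) hb

/-- Some branch at `u` leads to any other vertex of the component of `u`. -/
lemma exists_isBranch_mem {u v : V} (h : G.Reachable u v) (huv : u ≠ v) :
    ∃ C, G.IsBranch u C ∧ v ∈ C := by
  refine ⟨G.compOff u v, ⟨notMem_compOff u v, connOn_compOff u v, compOff_closed, ?_⟩,
    mem_compOff huv⟩
  by_contra! hcon
  refine notMem_compOff u v (h.symm.mem_of_closed (K := G.compOff u v) ?_ (mem_compOff huv))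
  intro a ha b hab
  refine (compOff_closed a ha b hab).resolve_right ?_
  rintro rfl
  exact hcon a ha hab.symm

lemma exists_mem_blockSets_ne {u w : V} (h : G.Adj u w) {S : Set V} (hS : S ∈ G.blockSets) :
    ∃ x ∈ S, x ≠ u := by
  by_contra! hcon
  have : w ∈ S := hS.2 (isNonsep_pair h) (fun x hx => Or.inl (hcon x hx)) (Or.inr rfl)
  exact h.ne (hcon w this).symm

/-- Each branch at `u` contains, up to `u`, exactly one block at `u`. -/
lemma IsBranch.existsUnique_block [Finite V] {u : V} {C : Set V} (hC : G.IsBranch u C) :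
    ∃! S, S ∈ G.blockSets ∧ u ∈ S ∧ (S ∩ C).Nonempty := by
  obtain ⟨huC, hconn, hcl, c, hcC, huc⟩ := hC
  obtain ⟨B, hB, hsub⟩ := (isNonsep_pair huc).exists_blockSet
  have huB : u ∈ B := hsub (Or.inl rfl)
  have hcB : c ∈ B := hsub (Or.inr rfl)
  refine ⟨B, ⟨hB, huB, c, hcB, hcC⟩, ?_⟩
  rintro S ⟨hS, huS, s, hsS, hsC⟩
  have hsu : s ≠ u := fun h => huC (h ▸ hsC)
  obtain ⟨w, hwS, huw⟩ := hS.1.2.1.exists_adj huS hsS hsu.symm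
  have hwC : w ∈ C := (hS.1.subset_insert huC hcl ⟨s, hsS, hsC⟩ hwS).resolve_left huw.ne'
  obtain ⟨T, hT, huT, hcT, hwT⟩ := exists_isNonsep_of_connOn hconn huC hcC hwC huc huw
  obtain ⟨B', hB', hTB'⟩ := hT.exists_blockSet
  rw [blockSets_eq_of_two_mem hS hB' huw.ne ⟨huS, hTB' huT⟩ ⟨hwS, hTB' hwT⟩,
    blockSets_eq_of_two_mem hB hB' huc.ne ⟨huB, hTB' huT⟩ ⟨hcB, hTB' hcT⟩]

/-- Every block at a non-isolated vertex `u` lies in one branch at `u`. -/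
lemma exists_branch_of_block {u w : V} (huw : G.Adj u w) {S : Set V} (hS : S ∈ G.blockSets)
    (hu : u ∈ S) : ∃ C, G.IsBranch u C ∧ (S ∩ C).Nonempty := by
  obtain ⟨x, hx, hxu⟩ := exists_mem_blockSets_ne huw hS
  obtain ⟨y, hy, huy⟩ := hS.1.2.1.exists_adj hu hx hxu.symm
  exact ⟨_, isBranch_compOff huy, y, hy, mem_compOff huy.ne⟩

/-- The blocks at a non-isolated vertex correspond to the branches at it. -/
lemma ncard_blockSets_eq_ncard_branches [Finite V] {u w : V} (huw : G.Adj u w) :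
    {S | S ∈ G.blockSets ∧ u ∈ S}.ncard = {C | G.IsBranch u C}.ncard := by
  choose! f hf using fun (S : Set V) (h : S ∈ G.blockSets ∧ u ∈ S) =>
    exists_branch_of_block huw h.1 h.2
  refine Set.ncard_congr (fun S _ => f S) (fun S hS => (hf S hS).1) ?_ ?_
  · intro S T hS hT hST
    refine (hf S hS).1.existsUnique_block.unique ⟨hS.1, hS.2, (hf S hS).2⟩ ⟨hT.1, hT.2, ?_⟩
    rw [show f S = f T from hST]
    exact (hf T hT).2
  · intro C hC
    obtain ⟨S, hS, huS, x, hxS, hxC⟩ := (hC : G.IsBranch u C).existsUnique_block.exists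
    refine ⟨S, ⟨hS, huS⟩, ?_⟩
    obtain ⟨h1, y, hyS, hyf⟩ := hf S ⟨hS, huS⟩
    have := hS.1.subset_insert hC.1 hC.2.2.1 ⟨x, hxS, hxC⟩ hyS
    exact h1.eq_of_mem hC hyf (this.resolve_left fun h => h1.1 (h ▸ hyf))

/-- All but one of the branches at `u` avoid a given other vertex of its component. -/
lemma ncard_branches_avoiding [Finite V] {u v : V} (h : G.Reachable u v) (huv : u ≠ v) :
    {C | G.IsBranch u C ∧ v ∉ C}.ncard + 1 = {S | S ∈ G.blockSets ∧ u ∈ S}.ncard := by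
  obtain ⟨C₀, hC₀, hv⟩ := exists_isBranch_mem h huv
  obtain ⟨-, -, -, c, -, huc⟩ := id hC₀
  rw [ncard_blockSets_eq_ncard_branches huc, ← Set.ncard_insert_of_notMem (a := C₀)
    (fun h => h.2 hv)]
  congr 1
  ext C
  constructor
  · rintro (rfl | h)
    · exact hC₀
    · exact h.1
  · intro hC
    by_cases hvC : v ∈ C
    · exact Or.inl (IsBranch.eq_of_mem hC hC₀ hvC hv)
    · exact Or.inr ⟨hC, hvC⟩

end BlockSets

end SimpleGraph

namespace SimpleGraph

section Blocks

variable {V W : Type} {G : SimpleGraph V} {H : SimpleGraph W}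

/-! ### Blocks as maximal nonseparable sets -/

lemma connOn_univ_iff : G.ConnOn Set.univ ↔ G.Preconnected := by
  refine ⟨fun h a b => connOn_reachable h trivial trivial, fun h K a _ haK hK b _ => ?_⟩
  exact (h a b).mem_of_closed (fun x hx y hxy => hK x trivial hx y trivial hxy) haK

lemma connOn_iff_preconnected_induce {S : Set V} : G.ConnOn S ↔ (G.induce S).Preconnected := by
  rw [← connOn_univ_iff]
  constructor
  · intro h K a _ haK hK b _
    obtain ⟨_, h2⟩ := h {x | ∃ hx : x ∈ S, (⟨x, hx⟩ : S) ∈ K} a a.2 ⟨a.2, haK⟩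
      (by
        rintro x hx ⟨_, hxK⟩ y hy hxy
        exact ⟨hy, hK ⟨x, hx⟩ trivial hxK ⟨y, hy⟩ trivial hxy⟩) b.2
    exact h2
  · intro h
    have := h.image (H := G) Subtype.val (fun a _ b _ hab => hab)
    simpa using this

lemma IsNonsep.preimage {T : Set W} (hT : H.IsNonsep T) {f : V → W} (hf : f.Injective)
    (hTf : T ⊆ Set.range f) (hadj : ∀ a b, H.Adj (f a) (f b) → G.Adj a b) :
    G.IsNonsep (f ⁻¹' T) := by
  obtain ⟨y, hy⟩ := hT.1
  obtain ⟨x, -⟩ := hTf hy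
  have : Nonempty V := ⟨x⟩
  have hinv : ∀ z ∈ T, f (Function.invFun f z) = z := fun z hz => Function.invFun_eq (hTf hz)
  have himg : Function.invFun f '' T = f ⁻¹' T := by
    ext z
    constructor
    · rintro ⟨t, ht, rfl⟩
      rwa [Set.mem_preimage, hinv t ht]
    · exact fun hz => ⟨f z, hz, Function.leftInverse_invFun hf z⟩
  rw [← himg]
  refine hT.image _ (fun a ha b hb hab => ?_) fun a ha b hb hab => hadj _ _ ?_
  · rw [← hinv a ha, hab, hinv b hb]
  · rwa [hinv a ha, hinv b hb]

lemma isTwoConnected_iff [Finite V] :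
    G.IsTwoConnected ↔ 3 ≤ Nat.card V ∧ G.IsNonsep Set.univ := by
  refine and_congr_right fun h3 => ?_
  have hcompl : ∀ v : V, (G.induce {v}ᶜ).Connected ↔ G.ConnOn (Set.univ \ {v}) := by
    intro v
    rw [← Set.compl_eq_univ_sdiff, connOn_iff_preconnected_induce, connected_iff]
    refine and_iff_left ?_
    by_contra hne
    rw [Set.nonempty_coe_sort, Set.not_nonempty_iff_eq_empty, Set.compl_empty_iff] at hne
    have := Set.ncard_univ V
    rw [← hne, Set.ncard_singleton] at this
    omega
  have hV : Nonempty V := (Nat.card_pos_iff.1 (by omega)).1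
  rw [IsNonsep, connOn_univ_iff, connected_iff]
  simp only [hcompl]
  simp [hV, Set.univ_nonempty]

lemma Subgraph.isNonsep_verts_of_isTwoConnected [Finite V] {B : G.Subgraph}
    (h : B.coe.IsTwoConnected) : 3 ≤ B.verts.ncard ∧ G.IsNonsep B.verts := by
  rw [isTwoConnected_iff] at h
  refine ⟨h.1, ?_⟩
  have := h.2.image (H := G) Subtype.val Subtype.val_injective.injOn
    (fun a _ b _ hab => B.adj_sub hab)
  simpa using this

lemma isTwoConnected_induce_top [Finite V] {S : Set V} (h3 : 3 ≤ S.ncard) (hS : G.IsNonsep S) :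
    ((⊤ : G.Subgraph).induce S).coe.IsTwoConnected := by
  rw [isTwoConnected_iff]
  refine ⟨h3, ?_⟩
  have := hS.preimage (G := ((⊤ : G.Subgraph).induce S).coe) Subtype.val_injective
    (by rw [Subtype.range_coe]; exact subset_rfl) fun a b hab => ⟨a.2, b.2, hab⟩
  convert this using 1
  exact (Set.eq_univ_of_forall fun x => x.2).symm

lemma Subgraph.le_induce_verts (B : G.Subgraph) : B ≤ (⊤ : G.Subgraph).induce B.verts :=
  ⟨subset_rfl, fun _ _ h => ⟨B.edge_vert h, B.edge_vert h.symm, B.adj_sub h⟩⟩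

/-- A connected set that does not contain both ends of an edge stays connected without it. -/
lemma ConnOn.reachable_deleteEdges {D : Set V} (hD : G.ConnOn D) {u v a b : V}
    (huv : ¬ (u ∈ D ∧ v ∈ D)) (ha : a ∈ D) (hb : b ∈ D) :
    (G.deleteEdges {s(u, v)}).Reachable a b := by
  refine connOn_reachable (S := D) ?_ ha hb
  have := hD.image (H := G.deleteEdges {s(u, v)}) id (fun x hx y hy hxy => by
    simp only [id, deleteEdges_adj, Set.mem_singleton_iff, Sym2.eq_iff]
    refine ⟨hxy, ?_⟩
    rintro (⟨rfl, rfl⟩ | ⟨rfl, rfl⟩)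
    · exact huv ⟨hx, hy⟩
    · exact huv ⟨hy, hx⟩)
  simpa using this

/-- A bridge is contained in no larger nonseparable set. -/
lemma IsBridge.pair_mem_blockSets {u v : V} (h : G.Adj u v) (hb : G.IsBridge s(u, v)) :
    {u, v} ∈ G.blockSets := by
  refine ⟨isNonsep_pair h, fun T hT hsub x hx => ?_⟩
  by_contra hxuv
  simp only [Set.mem_insert_iff, Set.mem_singleton_iff, not_or] at hxuv
  refine isBridge_iff.1 hb (Reachable.trans
    ((hT.2.2 v).reachable_deleteEdges (b := x) (fun h => h.2.2 rfl) ⟨hsub (Or.inl rfl), h.ne⟩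
      ⟨hx, hxuv.2⟩)
    ((hT.2.2 u).reachable_deleteEdges (fun h => h.1.2 rfl) ⟨hx, hxuv.1⟩
      ⟨hsub (Or.inr rfl), h.ne'⟩))

/-- An edge forming a maximal nonseparable set is a bridge: otherwise a second neighbour of one end
is joined to the other end, which gives a cycle through the edge. -/
lemma isBridge_of_pair_mem_blockSets [Finite V] {u v : V} (h : G.Adj u v)
    (hS : {u, v} ∈ G.blockSets) : G.IsBridge s(u, v) := by
  rw [isBridge_iff]
  intro hreach
  have hv : v ∈ G.compOff u v := mem_compOff h.ne
  refine notMem_compOff u v (hreach.symm.mem_of_closed (K := G.compOff u v) ?_ hv)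
  intro a ha b hab
  rw [deleteEdges_adj] at hab
  refine (compOff_closed a ha b hab.1).resolve_right ?_
  rintro rfl
  obtain ⟨T, hT, hbT, hvT, haT⟩ := exists_isNonsep_of_connOn (connOn_compOff b v)
    (notMem_compOff b v) hv ha h hab.1.symm
  have hsub : ({b, v} : Set V) ⊆ T := by
    rintro x (rfl | rfl)
    · exact hbT
    · exact hvT
  rcases hS.2 hT hsub haT with rfl | haS
  · exact hab.1.ne rfl
  · rw [Set.mem_singleton_iff] at haS
    subst haS
    exact hab.2 Sym2.eq_swap

lemma IsIsolated.singleton_mem_blockSets {v : V} (h : G.IsIsolated v) : {v} ∈ G.blockSets := by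
  refine ⟨isNonsep_singleton v, fun T hT hsub x hx => ?_⟩
  by_contra hxv
  obtain ⟨y, -, hy⟩ := hT.2.1.exists_adj (hsub rfl) hx (Ne.symm hxv)
  exact h y hy

lemma isIsolated_of_singleton_mem_blockSets {v : V} (h : {v} ∈ G.blockSets) : G.IsIsolated v := by
  intro w hw
  obtain ⟨x, hx, hxv⟩ := exists_mem_blockSets_ne hw h
  exact hxv hx

/-- The blocks are the subgraphs induced by the maximal nonseparable sets. -/
lemma isBlock_iff [Finite V] {B : G.Subgraph} :
    G.IsBlock B ↔ B.verts ∈ G.blockSets ∧ B = (⊤ : G.Subgraph).induce B.verts := by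
  constructor
  · rintro (hB | ⟨u, v, h, hb, rfl⟩ | ⟨v, hv, rfl⟩)
    · obtain ⟨h3, hns⟩ := Subgraph.isNonsep_verts_of_isTwoConnected hB.1
      refine ⟨⟨hns, fun T hT hsub => ?_⟩, hB.eq_of_le (isTwoConnected_induce_top h3 hns)
        B.le_induce_verts⟩
      have h3T := h3.trans (Set.ncard_le_ncard hsub)
      exact (hB.2 (isTwoConnected_induce_top h3T hT)
        (B.le_induce_verts.trans (Subgraph.induce_mono_right hsub))).1
    · rw [Subgraph.subgraphOfAdj_eq_induce]
      exact ⟨hb.pair_mem_blockSets h, rfl⟩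
    · rw [Subgraph.singletonSubgraph_eq_induce]
      exact ⟨hv.singleton_mem_blockSets, rfl⟩
  · rintro ⟨hS, hB⟩
    by_cases h3 : 3 ≤ B.verts.ncard
    · left
      rw [hB]
      refine ⟨isTwoConnected_induce_top h3 hS.1, fun B' hB' hle => ?_⟩
      have hsub : B.verts ⊆ B'.verts := hle.1
      have heq := hS.eq_of_subset (Subgraph.isNonsep_verts_of_isTwoConnected hB').2 hsub
      rw [heq]
      exact B'.le_induce_verts
    · right
      have hpos : 0 < B.verts.ncard := (Set.ncard_pos).2 hS.1.1
      have h12 : B.verts.ncard = 1 ∨ B.verts.ncard = 2 := by omega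
      rcases h12 with h1 | h2
      · right
        obtain ⟨v, hv⟩ := Set.ncard_eq_one.1 h1
        rw [hv] at hS hB
        exact ⟨v, isIsolated_of_singleton_mem_blockSets hS, by
          rw [hB, Subgraph.singletonSubgraph_eq_induce]⟩
      · left
        obtain ⟨u, v, huv, hv⟩ := Set.ncard_eq_two.1 h2
        rw [hv] at hS hB
        have hadj : G.Adj u v := by
          obtain ⟨x, hx, hux⟩ := hS.1.2.1.exists_adj (Or.inl rfl) (Or.inr rfl) huv
          rcases hx with rfl | rfl
          · exact absurd hux (G.irrefl)
          · exact hux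
        exact ⟨u, v, hadj, isBridge_of_pair_mem_blockSets hadj hS, by
          rw [hB, Subgraph.subgraphOfAdj_eq_induce]⟩

lemma isBlock_induce [Finite V] {S : Set V} (hS : S ∈ G.blockSets) :
    G.IsBlock ((⊤ : G.Subgraph).induce S) :=
  isBlock_iff.2 ⟨hS, rfl⟩

lemma numBlocks_eq [Finite V] : G.numBlocks = G.blockSets.ncard := by
  refine Set.ncard_congr (fun B _ => B.verts) (fun B hB => (isBlock_iff.1 hB).1) ?_
    fun S hS => ⟨_, isBlock_induce hS, rfl⟩
  intro B B' hB hB' h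
  rw [(isBlock_iff.1 hB).2, (isBlock_iff.1 hB').2, h]

lemma blockDegree_eq [Finite V] (v : V) :
    G.blockDegree v = {S | S ∈ G.blockSets ∧ v ∈ S}.ncard := by
  refine Set.ncard_congr (fun B _ => B.verts) (fun B hB => ⟨(isBlock_iff.1 hB.1).1, hB.2⟩) ?_
    fun S hS => ⟨_, ⟨isBlock_induce hS.1, hS.2⟩, rfl⟩
  intro B B' hB hB' h
  rw [(isBlock_iff.1 hB.1).2, (isBlock_iff.1 hB'.1).2, h]

/-- The blocks of the subgraph induced by a union of components `U` are the blocks of `G` inside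
`U`. -/
lemma mem_blockSets_induce {U : Set V} (hU : ∀ a ∈ U, ∀ b, G.Adj a b → b ∈ U) {S : Set U} :
    S ∈ (G.induce U).blockSets ↔ Subtype.val '' S ∈ G.blockSets := by
  have himg : ∀ {S : Set U}, (G.induce U).IsNonsep S → G.IsNonsep (Subtype.val '' S) :=
    fun h => h.image Subtype.val Subtype.val_injective.injOn fun _ _ _ _ hab => hab
  have hpre : ∀ {T : Set V}, G.IsNonsep T → T ⊆ U →
      (G.induce U).IsNonsep (Subtype.val ⁻¹' T) := by
    intro T hT hTU
    exact hT.preimage Subtype.val_injective (by rwa [Subtype.range_coe]) fun _ _ hab => hab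
  constructor
  · intro hS
    refine ⟨himg hS.1, fun T hT hsub => ?_⟩
    have hTU : T ⊆ U := by
      obtain ⟨s, hs⟩ := hS.1.1
      exact hT.2.1 U s (hsub ⟨s, hs, rfl⟩) s.2 fun x _ hxU y _ hxy => hU x hxU y hxy
    intro x hx
    exact ⟨⟨x, hTU hx⟩, hS.2 (hpre hT hTU) (Set.image_subset_iff.1 hsub) hx, rfl⟩
  · intro hS
    have h1 : (G.induce U).IsNonsep S := by
      have := hpre hS.1 (by rintro _ ⟨x, -, rfl⟩; exact x.2)
      rwa [Set.preimage_image_eq _ Subtype.val_injective] at this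
    refine ⟨h1, fun T hT hsub x hx => ?_⟩
    obtain ⟨y, hy, hyx⟩ := hS.2 (himg hT) (Set.image_mono hsub) ⟨x, hx, rfl⟩
    exact Subtype.val_injective hyx ▸ hy

/-- A bijection between the blocks of `G` inside a union of components `U` and the blocks of `H`
inside a union of components `U'` that matches isomorphic blocks gives `SameBlocks`. -/
lemma sameBlocks_induce [Finite V] [Finite W] {U : Set V} {U' : Set W}
    (hU : ∀ a ∈ U, ∀ b, G.Adj a b → b ∈ U) (hU' : ∀ a ∈ U', ∀ b, H.Adj a b → b ∈ U')
    (e : {S // S ∈ G.blockSets ∧ S ⊆ U} ≃ {S // S ∈ H.blockSets ∧ S ⊆ U'})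
    (he : ∀ S, Nonempty (G.induce S.1 ≃g H.induce (e S).1)) :
    SameBlocks (G.induce U) (H.induce U') := by
  have key : ∀ {V : Type} [Finite V] {G : SimpleGraph V} {U : Set V}
      (_ : ∀ a ∈ U, ∀ b, G.Adj a b → b ∈ U),
      ∃ f : {B : (G.induce U).Subgraph // (G.induce U).IsBlock B} ≃
        {S // S ∈ G.blockSets ∧ S ⊆ U}, ∀ B, Nonempty (B.1.coe ≃g G.induce (f B).1) := by
    intro V _ G U hU
    refine ⟨Equiv.ofBijective (fun B => ⟨Subtype.val '' B.1.verts,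
      (mem_blockSets_induce hU).1 (isBlock_iff.1 B.2).1, by rintro _ ⟨x, -, rfl⟩; exact x.2⟩)
      ⟨?_, ?_⟩, ?_⟩
    · intro B B' h
      have h1 : B.1.verts = B'.1.verts :=
        Subtype.val_injective.image_injective (Subtype.ext_iff.1 h)
      apply Subtype.ext
      rw [(isBlock_iff.1 B.2).2, (isBlock_iff.1 B'.2).2, h1]
    · rintro ⟨S, hS, hSU⟩
      have h1 : Subtype.val '' (Subtype.val ⁻¹' S : Set U) = S := by
        rw [Subtype.image_preimage_coe, Set.inter_eq_self_of_subset_right hSU]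
      refine ⟨⟨(⊤ : (G.induce U).Subgraph).induce (Subtype.val ⁻¹' S),
        isBlock_induce ((mem_blockSets_induce hU).2 (h1.symm ▸ hS))⟩, Subtype.ext h1⟩
    · rintro ⟨B, hB⟩
      have hB' := (isBlock_iff.1 hB).2
      refine ⟨⟨Equiv.Set.image _ B.verts Subtype.val_injective, ?_⟩⟩
      intro a b
      have h2 : B.coe.Adj a b ↔ ((⊤ : (G.induce U).Subgraph).induce B.verts).Adj a b := by
        rw [← hB', Subgraph.coe_adj]
      exact Iff.trans ⟨fun h => ⟨a.2, b.2, h⟩, fun h => h.2.2⟩ h2.symm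
  obtain ⟨f, hf⟩ := key hU
  obtain ⟨g, hg⟩ := key hU'
  refine ⟨(f.trans e).trans g.symm, fun B => ?_⟩
  obtain ⟨i⟩ := hf B
  obtain ⟨j⟩ := he (f B)
  obtain ⟨k⟩ := hg (g.symm (e (f B)))
  rw [Equiv.apply_symm_apply] at k
  exact ⟨(i.trans j).trans k.symm⟩

end Blocks

end SimpleGraph

namespace SimpleGraph

section Move

variable {V : Type} {G : SimpleGraph V} {u v : V} {C : Set V}

/-! ### Moving a branch from one vertex to another -/

open Classical in
/-- The graph obtained from `G` by detaching the branch `C` from `u` and attaching it to `v`: edges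
that meet `C` are read through the transposition of `u` and `v`. -/
def moveBranch (G : SimpleGraph V) (u v : V) (C : Set V) : SimpleGraph V where
  Adj a b := ((a ∈ C ∨ b ∈ C) ∧ G.Adj (Equiv.swap u v a) (Equiv.swap u v b)) ∨
    (¬ (a ∈ C ∨ b ∈ C) ∧ G.Adj a b)
  symm := ⟨fun a b h => by
    rcases h with ⟨h, hab⟩ | ⟨h, hab⟩
    · exact Or.inl ⟨h.symm, hab.symm⟩
    · exact Or.inr ⟨fun h' => h h'.symm, hab.symm⟩⟩
  loopless := ⟨fun a h => by
    rcases h with ⟨_, hab⟩ | ⟨_, hab⟩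
    · exact G.irrefl hab
    · exact G.irrefl hab⟩

open Classical in
/-- The effect of `moveBranch` on the vertex sets of blocks: those that meet the branch `C` have `u`
and `v` interchanged, the others stay. -/
noncomputable def moveSet (u v : V) (C S : Set V) : Set V :=
  if (S ∩ C).Nonempty then Equiv.swap u v '' S else S

lemma moveSet_of_nonempty [DecidableEq V] {S : Set V} (h : (S ∩ C).Nonempty) :
    moveSet u v C S = Equiv.swap u v '' S := by
  rw [moveSet, if_pos h]
  congr!

lemma moveSet_of_not_nonempty {S : Set V} (h : ¬ (S ∩ C).Nonempty) : moveSet u v C S = S :=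
  if_neg h

lemma swap_mem_iff [DecidableEq V] (hu : u ∉ C) (hv : v ∉ C) {a : V} :
    Equiv.swap u v a ∈ C ↔ a ∈ C := by
  rw [Equiv.swap_apply_def]
  split_ifs with h1 h2
  · subst h1; simp [hu, hv]
  · subst h2; simp [hu, hv]
  · rfl

lemma swap_of_mem [DecidableEq V] (hu : u ∉ C) (hv : v ∉ C) {a : V} (ha : a ∈ C) :
    Equiv.swap u v a = a :=
  Equiv.swap_apply_of_ne_of_ne (fun h => hu (h ▸ ha)) (fun h => hv (h ▸ ha))

lemma moveBranch_adj_of_mem [DecidableEq V] {a b : V} (h : a ∈ C ∨ b ∈ C) :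
    (G.moveBranch u v C).Adj a b ↔ G.Adj (Equiv.swap u v a) (Equiv.swap u v b) := by
  simp only [moveBranch, h, true_and, not_true_eq_false, false_and, or_false]
  congr!

lemma moveBranch_adj_of_notMem {a b : V} (h : ¬ (a ∈ C ∨ b ∈ C)) :
    (G.moveBranch u v C).Adj a b ↔ G.Adj a b := by
  simp only [moveBranch, h, false_and, not_false_eq_true, true_and, false_or]

lemma moveBranch_adj_of_mem_mem (hu : u ∉ C) (hv : v ∉ C) {a b : V} (ha : a ∈ C) (hb : b ∈ C) :
    (G.moveBranch u v C).Adj a b ↔ G.Adj a b := by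
  classical
  rw [moveBranch_adj_of_mem (Or.inl ha), swap_of_mem hu hv ha, swap_of_mem hu hv hb]

lemma moveBranch_moveBranch (hu : u ∉ C) (hv : v ∉ C) :
    (G.moveBranch u v C).moveBranch v u C = G := by
  classical
  ext a b
  by_cases h : a ∈ C ∨ b ∈ C
  · rw [moveBranch_adj_of_mem h, moveBranch_adj_of_mem, Equiv.swap_comm v u,
      Equiv.swap_apply_self, Equiv.swap_apply_self]
    rwa [swap_mem_iff hv hu, swap_mem_iff hv hu]
  · rw [moveBranch_adj_of_notMem h, moveBranch_adj_of_notMem h]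

lemma moveSet_inter_nonempty (hu : u ∉ C) (hv : v ∉ C) {S : Set V} :
    (moveSet u v C S ∩ C).Nonempty ↔ (S ∩ C).Nonempty := by
  classical
  by_cases h : (S ∩ C).Nonempty
  · rw [moveSet_of_nonempty h]
    refine iff_of_true ?_ h
    obtain ⟨c, hcS, hcC⟩ := h
    exact ⟨c, ⟨c, hcS, swap_of_mem hu hv hcC⟩, hcC⟩
  · rw [moveSet_of_not_nonempty h]

lemma moveSet_moveSet (hu : u ∉ C) (hv : v ∉ C) (S : Set V) :
    moveSet v u C (moveSet u v C S) = S := by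
  classical
  by_cases h : (S ∩ C).Nonempty
  · rw [moveSet_of_nonempty ((moveSet_inter_nonempty hu hv).2 h), moveSet_of_nonempty h,
      ← Set.image_comp, Equiv.swap_comm v u]
    simp
  · rw [moveSet_of_not_nonempty, moveSet_of_not_nonempty h]
    rwa [moveSet_inter_nonempty hu hv]

lemma mem_moveSet {S : Set V} {x : V} (hxu : x ≠ u) (hxv : x ≠ v) :
    x ∈ moveSet u v C S ↔ x ∈ S := by
  classical
  by_cases h : (S ∩ C).Nonempty
  · rw [moveSet_of_nonempty h, ← Equiv.swap_comm, Equiv.image_eq_preimage_symm, Equiv.symm_swap,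
      Set.mem_preimage, Equiv.swap_apply_of_ne_of_ne hxv hxu]
  · rw [moveSet_of_not_nonempty h]

lemma moveSet_subset_iff {U S : Set V} (hu : u ∈ U) (hv : v ∈ U) :
    moveSet u v C S ⊆ U ↔ S ⊆ U := by
  have : ∀ T T' : Set V, (∀ x, x ≠ u → x ≠ v → (x ∈ T ↔ x ∈ T')) → T ⊆ U → T' ⊆ U := by
    intro T T' h hT x hx
    by_cases hxu : x = u
    · exact hxu ▸ hu
    by_cases hxv : x = v
    · exact hxv ▸ hv
    exact hT ((h x hxu hxv).2 hx)
  exact ⟨this _ _ fun x hxu hxv => mem_moveSet hxu hxv,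
    this _ _ fun x hxu hxv => (mem_moveSet hxu hxv).symm⟩

/-- Inside a set within `C ∪ {u}`, the moved graph is the old one, up to the transposition. -/
lemma moveBranch_adj_swap [DecidableEq V] (hu : u ∉ C) (hv : v ∉ C) {a b : V}
    (ha : a ∈ insert u C) (hb : b ∈ insert u C) :
    (G.moveBranch u v C).Adj (Equiv.swap u v a) (Equiv.swap u v b) ↔ G.Adj a b := by
  by_cases h : a ∈ C ∨ b ∈ C
  · rw [moveBranch_adj_of_mem (by rwa [swap_mem_iff hu hv, swap_mem_iff hu hv]),
      Equiv.swap_apply_self, Equiv.swap_apply_self]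
  · rw [not_or] at h
    rw [ha.resolve_right h.1, hb.resolve_right h.2]
    exact iff_of_false (SimpleGraph.irrefl _) (SimpleGraph.irrefl _)

lemma IsNonsep.moveSet (hu : u ∉ C) (hv : v ∉ C)
    (hcl : ∀ a ∈ C, ∀ b, G.Adj a b → b ∈ C ∨ b = u) {S : Set V} (hS : G.IsNonsep S) :
    (G.moveBranch u v C).IsNonsep (moveSet u v C S) := by
  classical
  by_cases h : (S ∩ C).Nonempty
  · rw [moveSet_of_nonempty h]
    have hsub := hS.subset_insert hu hcl h
    exact hS.image _ (Equiv.injective _).injOn fun a ha b hb hab =>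
      (moveBranch_adj_swap hu hv (hsub ha) (hsub hb)).2 hab
  · rw [moveSet_of_not_nonempty h]
    have := hS.image (H := G.moveBranch u v C) id Function.injective_id.injOn
      (fun a ha b hb hab => (moveBranch_adj_of_notMem
        (by rintro (h' | h'); exacts [h ⟨a, ha, h'⟩, h ⟨b, hb, h'⟩])).2 hab)
    rwa [Set.image_id] at this

/-- A block and its image under `moveSet` are isomorphic. -/
lemma IsNonsep.nonempty_iso_moveSet (hu : u ∉ C) (hv : v ∉ C)
    (hcl : ∀ a ∈ C, ∀ b, G.Adj a b → b ∈ C ∨ b = u) {S : Set V} (hS : G.IsNonsep S) :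
    Nonempty (G.induce S ≃g (G.moveBranch u v C).induce (SimpleGraph.moveSet u v C S)) := by
  classical
  by_cases h : (S ∩ C).Nonempty
  · rw [moveSet_of_nonempty h]
    have hsub := hS.subset_insert hu hcl h
    exact ⟨⟨(Equiv.swap u v).image S, fun {a b} =>
      moveBranch_adj_swap hu hv (hsub a.2) (hsub b.2)⟩⟩
  · rw [moveSet_of_not_nonempty h]
    exact ⟨⟨Equiv.refl _, fun {a b} => moveBranch_adj_of_notMem
      (by rintro (h' | h'); exacts [h ⟨a, a.2, h'⟩, h ⟨b, b.2, h'⟩])⟩⟩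

lemma moveBranch_closed (hu : u ∉ C) (hv : v ∉ C)
    (hcl : ∀ a ∈ C, ∀ b, G.Adj a b → b ∈ C ∨ b = u) :
    ∀ a ∈ C, ∀ b, (G.moveBranch u v C).Adj a b → b ∈ C ∨ b = v := by
  classical
  intro a ha b hab
  rw [moveBranch_adj_of_mem (Or.inl ha), swap_of_mem hu hv ha] at hab
  rcases hcl a ha _ hab with h | h
  · exact Or.inl ((swap_mem_iff hu hv).1 h)
  · right
    rw [← Equiv.swap_apply_self u v b, h, Equiv.swap_apply_left]

/-- After the move, `C` is a branch at `v`. -/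
lemma IsBranch.moveBranch (hC : G.IsBranch u C) (hv : v ∉ C) :
    (G.moveBranch u v C).IsBranch v C := by
  classical
  obtain ⟨hu, hconn, hcl, c, hc, huc⟩ := hC
  refine ⟨hv, ?_, moveBranch_closed hu hv hcl, c, hc, ?_⟩
  · have := hconn.image (H := G.moveBranch u v C) id
      (fun a ha b hb hab => (moveBranch_adj_of_mem_mem hu hv ha hb).2 hab)
    rwa [Set.image_id] at this
  · rw [moveBranch_adj_of_mem (Or.inr hc), Equiv.swap_apply_right, swap_of_mem hu hv hc]
    exact huc

/-- The vertices `u` and `v` stay connected, by a path that avoids the moved branch. -/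
lemma reachable_moveBranch_ends (hu : u ∉ C) (hv : v ∉ C)
    (hcl : ∀ a ∈ C, ∀ b, G.Adj a b → b ∈ C ∨ b = u) (huv : G.Reachable u v) :
    (G.moveBranch u v C).Reachable u v := by
  have := huv.mem_of_closed (K := {x | (G.moveBranch u v C).Reachable u x ∨ x ∈ C}) (by
    rintro a (ha | ha) b hab
    · by_cases haC : a ∈ C
      · rcases hcl a haC b hab with h | rfl
        · exact Or.inr h
        · exact Or.inl (Reachable.refl _)
      by_cases hbC : b ∈ C
      · exact Or.inr hbC
      · refine Or.inl (ha.trans (Adj.reachable ?_))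
        exact (moveBranch_adj_of_notMem (by simp [haC, hbC])).2 hab
    · rcases hcl a ha b hab with h | rfl
      · exact Or.inr h
      · exact Or.inl (Reachable.refl _)) (Or.inl (Reachable.refl u))
  exact this.resolve_right hv

lemma reachable_moveBranch (hu : u ∉ C) (hv : v ∉ C)
    (hcl : ∀ a ∈ C, ∀ b, G.Adj a b → b ∈ C ∨ b = u) (huv : G.Reachable u v) {a b : V}
    (hab : G.Reachable a b) : (G.moveBranch u v C).Reachable a b := by
  classical
  have hends := reachable_moveBranch_ends hu hv hcl huv
  have hnew : ∀ x ∈ C, G.Adj x u → (G.moveBranch u v C).Adj x v := by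
    intro x hx hxu
    rwa [moveBranch_adj_of_mem (Or.inl hx), Equiv.swap_apply_right, swap_of_mem hu hv hx]
  refine hab.mem_of_closed (K := {x | (G.moveBranch u v C).Reachable a x}) ?_ (Reachable.refl a)
  intro x hx y hxy
  refine Reachable.trans hx ?_
  by_cases hxC : x ∈ C
  · rcases hcl x hxC y hxy with hyC | rfl
    · exact ((moveBranch_adj_of_mem_mem hu hv hxC hyC).2 hxy).reachable
    · exact (hnew x hxC hxy).reachable.trans hends.symm
  · by_cases hyC : y ∈ C
    · have hxu := (hcl y hyC x hxy.symm).resolve_left hxC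
      subst hxu
      exact hends.trans (hnew y hyC hxy.symm).reachable.symm
    · exact ((moveBranch_adj_of_notMem (by simp [hxC, hyC])).2 hxy).reachable

lemma reachable_moveBranch_iff (hC : G.IsBranch u C) (hv : v ∉ C) (huv : G.Reachable u v)
    {a b : V} : (G.moveBranch u v C).Reachable a b ↔ G.Reachable a b := by
  refine ⟨fun h => ?_, reachable_moveBranch hC.1 hv hC.2.2.1 huv⟩
  have := reachable_moveBranch (G := G.moveBranch u v C) hv hC.1
    (hC.moveBranch hv).2.2.1 (reachable_moveBranch_ends hC.1 hv hC.2.2.1 huv).symm h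
  rwa [moveBranch_moveBranch hC.1 hv] at this

lemma moveSet_mem_blockSets (hC : G.IsBranch u C) (hv : v ∉ C) (huv : G.Reachable u v)
    (hne : u ≠ v) {S : Set V} (hS : S ∈ G.blockSets) :
    moveSet u v C S ∈ (G.moveBranch u v C).blockSets := by
  have hC' := hC.moveBranch hv
  refine ⟨hS.1.moveSet hC.1 hv hC.2.2.1, fun T hT hsub => ?_⟩
  have hT' := hT.moveSet hv hC.1 hC'.2.2.1
  rw [moveBranch_moveBranch hC.1 hv] at hT'
  have hle : S ⊆ moveSet v u C T := by
    classical
    by_cases h : (S ∩ C).Nonempty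
    · rw [← moveSet_moveSet hC.1 hv S]
      have h1 := (moveSet_inter_nonempty (S := S) hC.1 hv).2 h
      rw [moveSet_of_nonempty h1,
        moveSet_of_nonempty (S := T) (h1.mono (Set.inter_subset_inter_left _ hsub))]
      exact Set.image_mono hsub
    · rw [moveSet_of_not_nonempty h] at hsub
      by_cases hTC : (T ∩ C).Nonempty
      · -- then `S = {v}`, which is impossible because `v` is not isolated
        exfalso
        have hTsub := hT.subset_insert hv hC'.2.2.1 hTC
        obtain ⟨D, ⟨-, -, -, d, hd, hvd⟩, -⟩ := exists_isBranch_mem huv.symm hne.symm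
        obtain ⟨x, hx, hxv⟩ := exists_mem_blockSets_ne hvd hS
        rcases hTsub (hsub hx) with h' | h'
        · exact hxv h'
        · exact h ⟨x, hx, h'⟩
      · rwa [moveSet_of_not_nonempty hTC]
  rw [hS.eq_of_subset hT' hle, moveSet_moveSet hv hC.1]

lemma moveSet_mem_blockSets_iff (hC : G.IsBranch u C) (hv : v ∉ C) (huv : G.Reachable u v)
    (hne : u ≠ v) {S : Set V} :
    moveSet u v C S ∈ (G.moveBranch u v C).blockSets ↔ S ∈ G.blockSets := by
  refine ⟨fun h => ?_, moveSet_mem_blockSets hC hv huv hne⟩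
  have := moveSet_mem_blockSets (hC.moveBranch hv) hC.1
    (reachable_moveBranch_ends hC.1 hv hC.2.2.1 huv).symm hne.symm h
  rwa [moveBranch_moveBranch hC.1 hv, moveSet_moveSet hC.1 hv] at this

/-- Moving a branch within its component does not change the class of `G` under `∼`. -/
lemma blockEquiv_moveBranch [Finite V] (hC : G.IsBranch u C) (hv : v ∉ C)
    (huv : G.Reachable u v) (hne : u ≠ v) : G.BlockEquiv (G.moveBranch u v C) := by
  have hreach : ∀ a b, G.Reachable a b ↔ (G.moveBranch u v C).Reachable a b :=
    fun a b => (reachable_moveBranch_iff hC hv huv).symm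
  have hcl : ∀ {H : SimpleGraph V} (c : H.ConnectedComponent), ∀ a ∈ c.supp, ∀ b, H.Adj a b →
      b ∈ c.supp := by
    intro H c a ha b hab
    rw [ConnectedComponent.mem_supp_iff] at ha ⊢
    rw [← ha]
    exact ConnectedComponent.sound hab.symm.reachable
  have hu : u ∉ C := hC.1
  let e : G.ConnectedComponent ≃ (G.moveBranch u v C).ConnectedComponent := Quot.congrRight hreach
  have hsupp : ∀ c, (e c).supp = c.supp := by
    intro c
    induction c using ConnectedComponent.ind with
    | h a =>
      ext b
      rw [ConnectedComponent.mem_supp_iff, ConnectedComponent.mem_supp_iff,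
        ConnectedComponent.eq, hreach]
      exact ConnectedComponent.eq
  refine ⟨e, fun c => ⟨hsupp c, ?_⟩⟩
  have hsub : ∀ S, moveSet u v C S ⊆ (e c).supp ↔ S ⊆ c.supp := by
    intro S
    rw [hsupp c]
    by_cases huc : u ∈ c.supp
    · refine moveSet_subset_iff huc ?_
      rw [ConnectedComponent.mem_supp_iff] at huc ⊢
      rw [← huc]
      exact ConnectedComponent.sound huv.symm
    · -- a component other than that of `u` and `v` does not meet `C`
      have hCc : ∀ x ∈ C, x ∉ c.supp := by
        obtain ⟨-, hconn, -, d, hd, hud⟩ := hC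
        intro x hx hxc
        rw [ConnectedComponent.mem_supp_iff] at huc hxc
        refine huc (hxc ▸ ConnectedComponent.sound ?_)
        exact hud.reachable.trans (connOn_reachable hconn hd hx)
      by_cases h : (S ∩ C).Nonempty
      · have h' := (moveSet_inter_nonempty hu hv).2 h
        obtain ⟨x, hx, hxC⟩ := h
        obtain ⟨y, hy, hyC⟩ := h'
        exact iff_of_false (fun h => hCc y hyC (h hy)) (fun h => hCc x hxC (h hx))
      · rw [moveSet_of_not_nonempty h]
  exact sameBlocks_induce (hcl c) (hcl _)
    (Equiv.subtypeEquiv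
      ⟨moveSet u v C, moveSet v u C, moveSet_moveSet hu hv, moveSet_moveSet hv hu⟩
      fun S => and_congr (moveSet_mem_blockSets_iff hC hv huv hne).symm (hsub S).symm)
    fun S => S.2.1.1.nonempty_iso_moveSet hu hv hC.2.2.1

/-! ### The effect of a move on the block-degrees -/

lemma blockDegree_moveBranch_of_ne [Finite V] (hC : G.IsBranch u C) (hv : v ∉ C)
    (huv : G.Reachable u v) (hne : u ≠ v) {x : V} (hxu : x ≠ u) (hxv : x ≠ v) :
    (G.moveBranch u v C).blockDegree x = G.blockDegree x := by
  rw [blockDegree_eq, blockDegree_eq]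
  symm
  refine Set.ncard_congr (fun S _ => moveSet u v C S) ?_ ?_ ?_
  · exact fun S hS => ⟨moveSet_mem_blockSets hC hv huv hne hS.1, (mem_moveSet hxu hxv).2 hS.2⟩
  · exact fun S T _ _ h => (moveSet_moveSet (u := u) hC.1 hv S).symm.trans
      ((congrArg (moveSet v u C) h).trans (moveSet_moveSet hC.1 hv T))
  · intro T hT
    have hC' := hC.moveBranch hv
    refine ⟨moveSet v u C T, ⟨?_, (mem_moveSet hxv hxu).2 hT.2⟩, moveSet_moveSet hv hC.1 T⟩
    have := moveSet_mem_blockSets hC' hC.1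
      (reachable_moveBranch_ends hC.1 hv hC.2.2.1 huv).symm hne.symm hT.1
    rwa [moveBranch_moveBranch hC.1 hv] at this

lemma blockDegree_moveBranch_left [Finite V] (hC : G.IsBranch u C) (hv : v ∉ C)
    (huv : G.Reachable u v) (hne : u ≠ v) :
    (G.moveBranch u v C).blockDegree u + 1 = G.blockDegree u := by
  classical
  have hC' := hC.moveBranch hv
  obtain ⟨B, ⟨hB, huB, hBC⟩, huniq⟩ := hC.existsUnique_block
  rw [blockDegree_eq, blockDegree_eq]
  have hBmem : B ∈ {S | S ∈ G.blockSets ∧ u ∈ S} := ⟨hB, huB⟩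
  rw [← Set.ncard_sdiff_singleton_add_one hBmem]
  congr 1
  symm
  -- the blocks at `u` that stay there are those that do not meet `C`
  have h0 : ∀ S ∈ {S | S ∈ G.blockSets ∧ u ∈ S} \ {B}, ¬ (S ∩ C).Nonempty :=
    fun S hS h => hS.2 (huniq S ⟨hS.1.1, hS.1.2, h⟩)
  refine Set.ncard_congr (fun S _ => moveSet u v C S) ?_ ?_ ?_
  · intro S hS
    refine ⟨moveSet_mem_blockSets hC hv huv hne hS.1.1, ?_⟩
    rw [moveSet_of_not_nonempty (h0 S hS)]
    exact hS.1.2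
  · exact fun S T _ _ h => (moveSet_moveSet (u := u) hC.1 hv S).symm.trans
      ((congrArg (moveSet v u C) h).trans (moveSet_moveSet hC.1 hv T))
  · intro T hT
    have hTC : ¬ (T ∩ C).Nonempty := fun h =>
      (hT.1.1.subset_insert hv hC'.2.2.1 h hT.2).elim hne hC.1
    have hTG := moveSet_mem_blockSets hC' hC.1
      (reachable_moveBranch_ends hC.1 hv hC.2.2.1 huv).symm hne.symm hT.1
    rw [moveBranch_moveBranch hC.1 hv, moveSet_of_not_nonempty hTC] at hTG
    refine ⟨T, ⟨⟨hTG, hT.2⟩, ?_⟩, moveSet_of_not_nonempty hTC⟩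
    rintro rfl
    exact hTC hBC

lemma blockDegree_moveBranch_right [Finite V] (hC : G.IsBranch u C) (hv : v ∉ C)
    (huv : G.Reachable u v) (hne : u ≠ v) :
    (G.moveBranch u v C).blockDegree v = G.blockDegree v + 1 := by
  have := blockDegree_moveBranch_left (hC.moveBranch hv) hC.1
    (reachable_moveBranch_ends hC.1 hv hC.2.2.1 huv).symm hne.symm
  rw [moveBranch_moveBranch hC.1 hv] at this
  exact this.symm

end Move

end SimpleGraph

/-! ### Double counting -/

lemma ncard_fibered {α β : Type} [Finite α] [Finite β] (S : Set α) (F : α → Set β) (k : ℕ)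
    (hF : ∀ a ∈ S, (F a).ncard = k) :
    {x : α × β | x.1 ∈ S ∧ x.2 ∈ F x.1}.ncard = S.ncard * k := by
  classical
  have := Fintype.ofFinite α
  have := Fintype.ofFinite β
  rw [Set.ncard_eq_toFinset_card' S, Set.ncard_eq_toFinset_card',
    Finset.card_eq_sum_card_fiberwise (f := Prod.fst) (t := S.toFinset) (by
      intro x hx
      have := Set.mem_toFinset.1 hx
      exact Set.mem_toFinset.2 this.1),
    Finset.sum_const_nat]
  intro a ha
  rw [← hF a (Set.mem_toFinset.1 ha), Set.ncard_eq_toFinset_card']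
  symm
  refine Finset.card_bij (fun b _ => (a, b)) ?_ ?_ ?_
  · intro b hb
    simpa using ⟨Set.mem_toFinset.1 ha, Set.mem_toFinset.1 hb⟩
  · intro b _ b' _ h
    exact (Prod.ext_iff.1 h).2
  · rintro ⟨x, b⟩ hx
    simp only [Finset.mem_filter, Set.mem_toFinset, Set.mem_ofPred_eq] at hx
    obtain ⟨⟨-, hb⟩, rfl⟩ := hx
    exact ⟨b, Set.mem_toFinset.2 hb, rfl⟩

namespace SimpleGraph

section Counting

variable {V : Type} {G : SimpleGraph V}

/-- Double counting of the pairs of a graph and a branch to be moved from `u` to `v`, or back: a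
graph with `p + 1` blocks at `u` has `p` branches at `u` that avoid `v`. -/
lemma ncard_mul_eq_of_move [Finite V] {u v : V} (hne : u ≠ v) {S₁ S₂ : Set (SimpleGraph V)}
    {p q : ℕ} (hr₁ : ∀ G ∈ S₁, G.Reachable u v) (hr₂ : ∀ G ∈ S₂, G.Reachable u v)
    (hp : ∀ G ∈ S₁, G.blockDegree u = p + 1) (hq : ∀ G ∈ S₂, G.blockDegree v = q + 1)
    (h₁ : ∀ G ∈ S₁, ∀ C, G.IsBranch u C → v ∉ C → G.moveBranch u v C ∈ S₂)
    (h₂ : ∀ G ∈ S₂, ∀ C, G.IsBranch v C → u ∉ C → G.moveBranch v u C ∈ S₁) :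
    S₁.ncard * p = S₂.ncard * q := by
  rw [← ncard_fibered S₁ (fun G => {C | G.IsBranch u C ∧ v ∉ C}) p (fun G hG => by
      have h := ncard_branches_avoiding (hr₁ G hG) hne
      rw [← blockDegree_eq, hp G hG] at h
      exact Nat.succ_injective h),
    ← ncard_fibered S₂ (fun G => {C | G.IsBranch v C ∧ u ∉ C}) q (fun G hG => by
      have h := ncard_branches_avoiding (hr₂ G hG).symm hne.symm
      rw [← blockDegree_eq, hq G hG] at h
      exact Nat.succ_injective h)]
  refine Set.ncard_congr (fun x _ => (x.1.moveBranch u v x.2, x.2)) ?_ ?_ ?_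
  · rintro ⟨G, C⟩ ⟨hG, hC, hv⟩
    exact ⟨h₁ G hG C hC hv, hC.moveBranch hv, hC.1⟩
  · rintro ⟨G, C⟩ ⟨G', C'⟩ ⟨-, hC, hv⟩ ⟨-, hC', hv'⟩ h
    obtain ⟨hG, rfl⟩ := Prod.ext_iff.1 h
    refine Prod.ext ?_ rfl
    have hG' := congrArg (fun H : SimpleGraph V => H.moveBranch v u C) hG
    simpa only [moveBranch_moveBranch hC.1 hv] using hG'
  · rintro ⟨G, C⟩ ⟨hG, hC, hu⟩
    exact ⟨(G.moveBranch v u C, C), ⟨h₂ G hG C hC hu, hC.moveBranch hu, hC.1⟩,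
      Prod.ext (moveBranch_moveBranch hC.1 hu) rfl⟩

lemma blockDegree_pos [Finite V] (v : V) : 0 < G.blockDegree v := by
  rw [blockDegree_eq, Set.ncard_pos]
  obtain ⟨B, hB, hv⟩ := (isNonsep_singleton (G := G) v).exists_blockSet
  exact ⟨B, hB, hv rfl⟩

/-! ### Blocks and block-degrees within a component -/

/-- `W` is the vertex set of a connected component of `G`. -/
def IsComp (G : SimpleGraph V) (W : Finset V) : Prop :=
  W.Nonempty ∧ ∀ r ∈ W, ∀ x, x ∈ W ↔ G.Reachable r x

lemma IsComp.eq_of_mem {W W' : Finset V} (h : G.IsComp W) (h' : G.IsComp W') {x : V} (hx : x ∈ W)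
    (hx' : x ∈ W') : W = W' := by
  ext y
  rw [h.2 x hx, h'.2 x hx']

/-- The blocks at `x` that do not lead to `r`. -/
def blocksAwayFrom (G : SimpleGraph V) (r x : V) : Set (Set V) :=
  {S | S ∈ G.blockSets ∧ x ∈ S ∧ ∀ C, G.IsBranch x C → r ∈ C → ¬ (S ∩ C).Nonempty}

/-- A block leads away from `r` at no more than one of its vertices. -/
lemma eq_of_mem_blocksAwayFrom {r x y : V} (hx : G.Reachable r x) (hy : G.Reachable r y)
    {S : Set V} (hSx : S ∈ G.blocksAwayFrom r x) (hSy : S ∈ G.blocksAwayFrom r y) : x = y := by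
  by_contra hxy
  obtain ⟨C, hC, hyC⟩ := exists_isBranch_mem (hx.symm.trans hy) hxy
  obtain ⟨C', hC', hxC'⟩ := exists_isBranch_mem (hy.symm.trans hx) (Ne.symm hxy)
  have hr := hy.symm.mem_of_closed (K := C ∪ C') (by
    rintro a (ha | ha) b hab
    · rcases hC.2.2.1 a ha b hab with h | rfl
      · exact Or.inl h
      · exact Or.inr hxC'
    · rcases hC'.2.2.1 a ha b hab with h | rfl
      · exact Or.inr h
      · exact Or.inl hyC) (Or.inl hyC)
  rcases hr with hr | hr
  · exact hSx.2.2 C hC hr ⟨y, hSy.2.1, hyC⟩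
  · exact hSy.2.2 C' hC' hr ⟨x, hSx.2.1, hxC'⟩

lemma blockDegree_sub_one_le [Finite V] {r x : V} (h : G.Reachable r x) :
    G.blockDegree x - 1 ≤ (G.blocksAwayFrom r x).ncard := by
  rw [blockDegree_eq]
  by_cases hxr : x = r
  · subst hxr
    refine (Nat.sub_le _ _).trans (Set.ncard_le_ncard fun S hS => ⟨hS.1, hS.2, fun C hC hxC => ?_⟩)
    exact absurd hxC hC.1
  · obtain ⟨C₀, hC₀, hr⟩ := exists_isBranch_mem h.symm hxr
    obtain ⟨B, -, huniq⟩ := hC₀.existsUnique_block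
    rw [Nat.sub_le_iff_le_add]
    refine (Set.ncard_le_ncard (t := insert B (G.blocksAwayFrom r x)) fun S hS => ?_).trans
      (Set.ncard_insert_le _ _)
    by_cases hSC : (S ∩ C₀).Nonempty
    · exact Or.inl (huniq S ⟨hS.1, hS.2, hSC⟩)
    · exact Or.inr ⟨hS.1, hS.2, fun C hC hrC => (hC.eq_of_mem hC₀ hrC hr) ▸ hSC⟩

lemma blockDegree_le_ncard_blocksAwayFrom_self [Finite V] (r : V) :
    G.blockDegree r ≤ (G.blocksAwayFrom r r).ncard := by
  rw [blockDegree_eq]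
  exact Set.ncard_le_ncard fun S hS => ⟨hS.1, hS.2, fun C hC hxC => absurd hxC hC.1⟩

lemma blockSets_subset_isComp {W : Finset V} (hW : G.IsComp W) {x : V} (hx : x ∈ W) {S : Set V}
    (hS : S ∈ G.blockSets) (hxS : x ∈ S) : S ⊆ W :=
  fun _ hy => (hW.2 x hx _).2 (connOn_reachable hS.1.2.1 hxS hy)

/-- Counting each block at the vertex nearest to a root: the excess block-degrees of a component sum
to less than the number of its blocks. -/
lemma sum_blockDegree_sub_one_lt [Finite V] {W : Finset V} (hW : G.IsComp W) :
    ∑ x ∈ W, (G.blockDegree x - 1) + 1 ≤ {S | S ∈ G.blockSets ∧ S ⊆ W}.ncard := by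
  classical
  have := Fintype.ofFinite V
  obtain ⟨r, hr⟩ := hW.1
  have h1 : ∑ x ∈ W, (G.blockDegree x - 1) + 1 ≤ ∑ x ∈ W, (G.blocksAwayFrom r x).ncard := by
    rw [← Finset.add_sum_erase _ _ hr, ← Finset.add_sum_erase _ _ hr]
    have h2 := G.blockDegree_pos r
    have h3 := G.blockDegree_le_ncard_blocksAwayFrom_self r
    have h4 : ∑ x ∈ W.erase r, (G.blockDegree x - 1) ≤
        ∑ x ∈ W.erase r, (G.blocksAwayFrom r x).ncard :=
      Finset.sum_le_sum fun x hx =>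
        blockDegree_sub_one_le ((hW.2 r hr x).1 (Finset.mem_of_mem_erase hx))
    omega
  refine h1.trans ?_
  simp only [Set.ncard_eq_toFinset_card']
  rw [← Finset.card_biUnion]
  · refine Finset.card_le_card fun S hS => ?_
    simp only [Finset.mem_biUnion, Set.mem_toFinset] at hS ⊢
    obtain ⟨x, hx, hS⟩ := hS
    exact ⟨hS.1, blockSets_subset_isComp hW hx hS.1 hS.2.1⟩
  · intro x hx y hy hxy
    refine Finset.disjoint_left.2 fun S hSx hSy => ?_
    rw [Set.mem_toFinset] at hSx hSy
    exact hxy (eq_of_mem_blocksAwayFrom ((hW.2 r hr x).1 hx) ((hW.2 r hr y).1 hy) hSx hSy)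

/-- Every block is the one leading to the root at some vertex other than the root. -/
lemma ncard_blockSets_add_one_le [Finite V] {W : Finset V} (hW : G.IsComp W)
    (h2 : 2 ≤ W.card) : {S | S ∈ G.blockSets ∧ S ⊆ W}.ncard + 1 ≤ W.card := by
  classical
  have := Fintype.ofFinite V
  obtain ⟨r, hr⟩ := hW.1
  rw [← Finset.card_erase_add_one hr, Set.ncard_eq_toFinset_card']
  refine Nat.succ_le_succ ?_
  have hbr : ∀ x ∈ W.erase r, ∃ B, ∃ C, G.IsBranch x C ∧ r ∈ C ∧
      ∀ S ∈ G.blockSets, x ∈ S → (S ∩ C).Nonempty → S = B := by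
    intro x hx
    obtain ⟨hxr, hx⟩ := Finset.mem_erase.1 hx
    obtain ⟨C, hC, hrC⟩ := exists_isBranch_mem ((hW.2 r hr x).1 hx).symm hxr
    obtain ⟨B, -, huniq⟩ := hC.existsUnique_block
    exact ⟨B, C, hC, hrC, fun S hS hxS hSC => huniq S ⟨hS, hxS, hSC⟩⟩
  choose! f C hC hrC hf using hbr
  refine (Finset.card_le_card (t := (W.erase r).image f) fun S hS => ?_).trans
    Finset.card_image_le
  simp only [Set.mem_toFinset, Set.mem_ofPred_eq] at hS
  obtain ⟨hS, hSW⟩ := hS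
  obtain ⟨p, hp⟩ := hS.1.1
  have hpW : p ∈ W := hSW hp
  obtain ⟨q', hq'W, hq'⟩ := Finset.exists_mem_ne (s := W) (by omega) p
  obtain ⟨D, ⟨-, -, -, d, -, hpd⟩, -⟩ :=
    exists_isBranch_mem ((hW.2 p hpW q').1 hq'W) hq'.symm
  obtain ⟨q, hq, hqp⟩ := exists_mem_blockSets_ne hpd hS
  have key : ∀ x ∈ S, S ∉ G.blocksAwayFrom r x → S ∈ (W.erase r).image f := by
    intro x hx hxT
    simp only [blocksAwayFrom, Set.mem_ofPred_eq, not_and, not_forall, not_not] at hxT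
    obtain ⟨C', hC', hrC', hSC'⟩ := hxT hS hx
    have hxW : x ∈ W.erase r :=
      Finset.mem_erase.2 ⟨fun h => hC'.1 (h ▸ hrC'), hSW hx⟩
    rw [hC'.eq_of_mem (hC x hxW) hrC' (hrC x hxW)] at hSC'
    exact Finset.mem_image.2 ⟨x, hxW, (hf x hxW S hS hx hSC').symm⟩
  by_cases hT : S ∈ G.blocksAwayFrom r p
  · exact key q hq fun hT' => hqp (eq_of_mem_blocksAwayFrom ((hW.2 r hr q).1 (hSW hq))
      ((hW.2 r hr p).1 hpW) hT' hT)
  · exact key p hp hT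

lemma sum_blockDegree_sub_one_le [Finite V] {W : Finset V} (hW : G.IsComp W) (h2 : 2 ≤ W.card) :
    ∑ x ∈ W, (G.blockDegree x - 1) + 2 ≤ W.card := by
  have h1 := sum_blockDegree_sub_one_lt hW
  have h3 := ncard_blockSets_add_one_le hW h2
  omega

lemma sum_blockDegree_sub_one_le_card [Finite V] {W : Finset V} (hW : G.IsComp W) :
    ∑ x ∈ W, (G.blockDegree x - 1) ≤ W.card := by
  by_cases h2 : 2 ≤ W.card
  · have := sum_blockDegree_sub_one_le hW h2
    omega
  · -- an isolated vertex lies in one block only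
    obtain ⟨r, hr⟩ := hW.1
    have h1 : W.card ≤ 1 := by omega
    have hsub : {S | S ∈ G.blockSets ∧ S ⊆ W} ⊆ {{r}} := by
      rintro S ⟨hS, hSW⟩
      have : ∀ x ∈ S, x = r := fun x hx => Finset.card_le_one.1 h1 x (hSW hx) r hr
      exact hS.1.1.subset_singleton_iff.1 this
    have h3 := Set.ncard_le_ncard hsub
    rw [Set.ncard_singleton] at h3
    have h4 := sum_blockDegree_sub_one_lt hW
    omega

open Classical in
lemma sum_isComp_card_le [Fintype V] :
    ∑ W ∈ Finset.univ.filter G.IsComp, W.card ≤ Fintype.card V := by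
  rw [← Finset.card_biUnion]
  · exact Finset.card_le_univ _
  · intro W hW W' hW' hne
    simp only [Finset.coe_filter, Finset.mem_univ, true_and, Set.mem_ofPred_eq] at hW hW'
    exact Finset.disjoint_left.2 fun x hx hx' => hne (hW.eq_of_mem hW' hx hx')

open Classical in
lemma sum_isComp_blockDegree_le_card [Fintype V] :
    ∑ W ∈ Finset.univ.filter G.IsComp, ∑ x ∈ W, (G.blockDegree x - 1) ≤ Fintype.card V :=
  (Finset.sum_le_sum fun _ hW => sum_blockDegree_sub_one_le_card
    (Finset.mem_filter.1 hW).2).trans sum_isComp_card_le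

open Classical in
lemma sum_isComp_blockDegree_le_numBlocks [Fintype V] :
    ∑ W ∈ Finset.univ.filter G.IsComp, ∑ x ∈ W, (G.blockDegree x - 1) ≤ G.numBlocks := by
  refine (Finset.sum_le_sum fun W hW => (Nat.le_succ _).trans
    (sum_blockDegree_sub_one_lt (Finset.mem_filter.1 hW).2)).trans ?_
  simp only [numBlocks_eq, Set.ncard_eq_toFinset_card']
  rw [← Finset.card_biUnion]
  · refine Finset.card_le_card fun S hS => ?_
    simp only [Finset.mem_biUnion, Set.mem_toFinset] at hS ⊢
    obtain ⟨_, _, hS⟩ := hS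
    exact hS.1
  · intro W hW W' hW' hne
    simp only [Finset.coe_filter, Finset.mem_univ, true_and, Set.mem_ofPred_eq] at hW hW'
    refine Finset.disjoint_left.2 fun S hS hS' => hne ?_
    rw [Set.mem_toFinset] at hS hS'
    obtain ⟨x, hx⟩ := hS.1.1.1
    exact hW.eq_of_mem hW' (hS.2 hx) (hS'.2 hx)

end Counting

end SimpleGraph

/-! ### Multinomial laws: letter counts of uniform words -/

section Words

variable {ι α : Type}

open Classical in
/-- The number of occurrences of each letter in the word `w`. -/
noncomputable def letterCount {m : ℕ} (w : Fin m → ι) (i : ι) : ℕ :=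
  (Finset.univ.filter fun j => w j = i).card

/-- A vector with entry sum `m + 1` has a positive entry. -/
lemma exists_eq_add_single [Fintype ι] [DecidableEq ι] {m : ℕ} {d : ι → ℕ}
    (hd : ∑ i, d i = m + 1) : ∃ (u : ι) (d₀ : ι → ℕ), d = d₀ + Pi.single u 1 ∧ ∑ i, d₀ i = m := by
  have : ∃ u, d u ≠ 0 := by
    by_contra! h
    simp [h] at hd
  obtain ⟨u, hu⟩ := this
  have hdu : d = (d - Pi.single u 1) + Pi.single u 1 := by
    ext i
    by_cases hi : i = u
    · subst hi
      simp only [Pi.add_apply, Pi.sub_apply, Pi.single_eq_same]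
      omega
    · simp [hi]
  refine ⟨u, d - Pi.single u 1, hdu, ?_⟩
  rw [hdu] at hd
  simp only [Pi.add_apply, Finset.sum_add_distrib, Finset.sum_pi_single', Finset.mem_univ,
    if_true] at hd
  omega

/-- A function of vectors that is unchanged when a unit moves between entries depends on the sum of
the entries only. -/
lemma eq_of_sum_eq_of_exchange [Fintype ι] [DecidableEq ι] (m : ℕ) :
    ∀ Ψ : (ι → ℕ) → ℕ,
      (∀ (u v : ι) (d : ι → ℕ), Ψ (d + Pi.single u 1) = Ψ (d + Pi.single v 1)) →
      ∀ d d' : ι → ℕ, ∑ i, d i = m → ∑ i, d' i = m → Ψ d = Ψ d' := by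
  induction m with
  | zero =>
    intro Ψ _ d d' hd hd'
    congr 1
    ext i
    rw [Finset.sum_eq_zero_iff] at hd hd'
    rw [hd i (Finset.mem_univ i), hd' i (Finset.mem_univ i)]
  | succ m ih =>
    intro Ψ hΨ d d' hd hd'
    obtain ⟨u, d₀, rfl, hd₀⟩ := exists_eq_add_single hd
    obtain ⟨v, d₀', rfl, hd₀'⟩ := exists_eq_add_single hd'
    rw [hΨ v u]
    refine ih (fun x => Ψ (x + Pi.single u 1)) (fun a b x => ?_) d₀ d₀' hd₀ hd₀'
    show Ψ (x + Pi.single a 1 + Pi.single u 1) = Ψ (x + Pi.single b 1 + Pi.single u 1)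
    rw [add_right_comm, hΨ a b, add_right_comm]

/-- The relation between the numbers of objects with two neighbouring statistics that characterizes
multinomial distributions, given the sum of the entries. -/
def ExchangeRel [DecidableEq ι] (N : (ι → ℕ) → ℕ) : Prop :=
  ∀ u v, u ≠ v → ∀ d : ι → ℕ,
    N (d + Pi.single u 1) * (d u + 1) = N (d + Pi.single v 1) * (d v + 1)

lemma ExchangeRel.mul_prod_factorial_eq [Fintype ι] [DecidableEq ι] {N : (ι → ℕ) → ℕ}
    (hN : ExchangeRel N) {d d' : ι → ℕ} (h : ∑ i, d i = ∑ i, d' i) :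
    N d * ∏ i, (d i).factorial = N d' * ∏ i, (d' i).factorial := by
  have hprod : ∀ u (d : ι → ℕ),
      ∏ i, ((d + Pi.single u 1 : ι → ℕ) i).factorial = (d u + 1) * ∏ i, (d i).factorial := by
    intro u d
    rw [← Finset.mul_prod_erase _ _ (Finset.mem_univ u),
      ← Finset.mul_prod_erase (a := u) _ _ (Finset.mem_univ u), ← mul_assoc]
    congr 1
    · simp [Nat.factorial_succ]
    · refine Finset.prod_congr rfl fun i hi => ?_
      simp [Finset.ne_of_mem_erase hi]
  refine eq_of_sum_eq_of_exchange _ (fun d => N d * ∏ i, (d i).factorial) (fun u v d => ?_) d d' h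
    rfl
  show N _ * _ = N _ * _
  by_cases huv : u = v
  · rw [huv]
  · rw [hprod, hprod, ← mul_assoc, ← mul_assoc, hN u v huv]

lemma ExchangeRel.mul_eq_mul [Fintype ι] [DecidableEq ι] {N M : (ι → ℕ) → ℕ}
    (hN : ExchangeRel N) (hM : ExchangeRel M) {d d' : ι → ℕ} (h : ∑ i, d i = ∑ i, d' i) :
    N d * M d' = N d' * M d := by
  have hpos : ∀ d : ι → ℕ, 0 < ∏ i, (d i).factorial := fun d =>
    Finset.prod_pos fun i _ => Nat.factorial_pos _
  have h1 := hN.mul_prod_factorial_eq h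
  have h2 := hM.mul_prod_factorial_eq h
  refine Nat.eq_of_mul_eq_mul_right (Nat.mul_pos (hpos d) (hpos d')) ?_
  calc N d * M d' * ((∏ i, (d i).factorial) * ∏ i, (d' i).factorial)
      = (N d * ∏ i, (d i).factorial) * (M d' * ∏ i, (d' i).factorial) := by ring
    _ = (N d' * ∏ i, (d' i).factorial) * (M d * ∏ i, (d i).factorial) := by rw [h1, h2]
    _ = _ := by ring

lemma letterCount_eq_sum [DecidableEq ι] {m : ℕ} (w : Fin m → ι) (i : ι) :
    letterCount w i = ∑ j, if w j = i then 1 else 0 := by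
  rw [letterCount, Finset.card_filter]
  congr!

lemma sum_letterCount [Fintype ι] {m : ℕ} (w : Fin m → ι) : ∑ i, letterCount w i = m := by
  classical
  simp only [letterCount_eq_sum]
  rw [Finset.sum_comm]
  simp

lemma letterCount_cons [DecidableEq ι] {m : ℕ} (i : ι) (w : Fin m → ι) :
    letterCount (Fin.cons i w : Fin (m + 1) → ι) = letterCount w + Pi.single i 1 := by
  ext j
  simp only [letterCount_eq_sum, Pi.add_apply, Pi.single_apply, Fin.sum_univ_succ, Fin.cons_zero,
    Fin.cons_succ, @eq_comm _ j]
  exact add_comm _ _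

lemma letterCount_update [DecidableEq ι] {m : ℕ} (w : Fin m → ι) (j : Fin m) (v : ι) :
    letterCount (Function.update w j v) + Pi.single (w j) 1 = letterCount w + Pi.single v 1 := by
  ext i
  simp only [letterCount_eq_sum, Pi.add_apply, Pi.single_apply, @eq_comm _ i]
  rw [← Finset.add_sum_erase _ _ (Finset.mem_univ j),
    ← Finset.add_sum_erase (a := j) _ _ (Finset.mem_univ j), Function.update_self,
    Finset.sum_congr rfl fun k hk => by rw [Function.update_of_ne (Finset.ne_of_mem_erase hk)]]
  ring

/-- Words satisfy the exchange relation: replace one letter `u` by `v`. -/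
lemma exchangeRel_letterCount [Finite ι] [DecidableEq ι] (m : ℕ) :
    ExchangeRel fun d => {w : Fin m → ι | letterCount w = d}.ncard := by
  have hfib : ∀ (u : ι) (d : ι → ℕ), ∀ w ∈ {w : Fin m → ι | letterCount w = d + Pi.single u 1},
      {j | w j = u}.ncard = d u + 1 := by
    intro u d w hw
    have h := congrFun (hw : letterCount w = _) u
    simp only [Pi.add_apply, Pi.single_eq_same] at h
    rw [← h, letterCount, Set.ncard_eq_toFinset_card']
    congr 1
    ext
    simp
  intro u v huv d
  show Set.ncard _ * _ = Set.ncard _ * _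
  rw [← ncard_fibered _ (fun w => {j | w j = u}) _ (hfib u d),
    ← ncard_fibered _ (fun w => {j | w j = v}) _ (hfib v d)]
  have key : ∀ (u v : ι) (w : Fin m → ι) (j : Fin m), letterCount w = d + Pi.single u 1 →
      w j = u → letterCount (Function.update w j v) = d + Pi.single v 1 := by
    intro u v w j hw hj
    have := letterCount_update w j v
    rw [hw, hj, add_right_comm] at this
    exact add_right_cancel this
  refine Set.ncard_congr (fun x _ => (Function.update x.1 x.2 v, x.2)) ?_ ?_ ?_
  · rintro ⟨w, j⟩ ⟨hw, hj⟩
    exact ⟨key u v w j hw hj, Function.update_self (f := w) ..⟩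
  · rintro ⟨w, j⟩ ⟨w', j'⟩ ⟨-, hj⟩ ⟨-, hj'⟩ h
    obtain ⟨h1, rfl⟩ := Prod.ext_iff.1 h
    have h2 := congrArg (fun z => Function.update z j u) h1
    simp only [Function.update_idem] at h2
    rw [← (hj : w j = u)] at h2
    rw [Function.update_eq_self, hj, ← (hj' : w' j = u), Function.update_eq_self] at h2
    exact Prod.ext h2 rfl
  · rintro ⟨w, j⟩ ⟨hw, hj⟩
    refine ⟨(Function.update w j u, j), ⟨key v u w j hw hj, Function.update_self (f := w) ..⟩, ?_⟩
    refine Prod.ext ?_ rfl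
    show Function.update (Function.update w j u) j v = w
    rw [Function.update_idem, ← (hj : w j = v), Function.update_eq_self]

/-- A statistic whose counts satisfy the exchange relation has, given that its entries sum to `m`,
the law of the letter counts of a uniform word of length `m`. -/
lemma ExchangeRel.sum_eq [Fintype ι] [DecidableEq ι] (S : Finset α) (e : α → ι → ℕ) (m : ℕ)
    (hm : ∀ a ∈ S, ∑ i, e a i = m)
    (hex : ExchangeRel fun d => (S.filter fun a => e a = d).card) (f : (ι → ℕ) → ℝ) :
    (Fintype.card ι : ℝ) ^ m * ∑ a ∈ S, f (e a) =
      S.card * ∑ w : Fin m → ι, f (letterCount w) := by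
  classical
  let D : Finset (ι → ℕ) := S.image e ∪ Finset.univ.image (letterCount (m := m))
  have hD : ∀ d ∈ D, ∑ i, d i = m := by
    intro d hd
    rcases Finset.mem_union.1 hd with h | h
    · obtain ⟨a, ha, rfl⟩ := Finset.mem_image.1 h
      exact hm a ha
    · obtain ⟨w, -, rfl⟩ := Finset.mem_image.1 h
      exact sum_letterCount w
  have hS : ∀ g : (ι → ℕ) → ℝ,
      ∑ a ∈ S, g (e a) = ∑ d ∈ D, ((S.filter fun a => e a = d).card : ℝ) * g d := by
    intro g
    rw [← Finset.sum_fiberwise_of_maps_to (t := D) (g := e) fun a ha =>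
      Finset.mem_union_left _ (Finset.mem_image_of_mem e ha)]
    refine Finset.sum_congr rfl fun d _ => ?_
    rw [Finset.sum_congr rfl fun a ha => by rw [(Finset.mem_filter.1 ha).2], Finset.sum_const,
      nsmul_eq_mul]
  have hw : ∀ g : (ι → ℕ) → ℝ, ∑ w : Fin m → ι, g (letterCount w) =
      ∑ d ∈ D, ({w : Fin m → ι | letterCount w = d}.ncard : ℝ) * g d := by
    intro g
    rw [← Finset.sum_fiberwise_of_maps_to (t := D) (g := letterCount) fun w hw =>
      Finset.mem_union_right _ (Finset.mem_image_of_mem _ hw)]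
    refine Finset.sum_congr rfl fun d _ => ?_
    rw [Finset.sum_congr rfl fun a ha => by rw [(Finset.mem_filter.1 ha).2], Finset.sum_const,
      nsmul_eq_mul, Set.ncard_eq_toFinset_card']
    congr 3
    ext
    simp
  have hcard : (S.card : ℝ) = ∑ d ∈ D, ((S.filter fun a => e a = d).card : ℝ) := by
    simpa using hS fun _ => 1
  have hpow : (Fintype.card ι : ℝ) ^ m =
      ∑ d ∈ D, ({w : Fin m → ι | letterCount w = d}.ncard : ℝ) := by
    simpa using hw fun _ => 1
  rw [hcard, hpow, hS f, hw f, Finset.sum_mul_sum, Finset.sum_mul_sum]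
  refine Finset.sum_congr rfl fun d hd => Finset.sum_congr rfl fun d' hd' => ?_
  have := hex.mul_eq_mul (exchangeRel_letterCount m) ((hD d hd).trans (hD d' hd').symm)
  have h' : ((S.filter fun a => e a = d).card : ℝ) *
      ({w : Fin m → ι | letterCount w = d'}.ncard : ℝ) =
      ((S.filter fun a => e a = d').card : ℝ) *
      ({w : Fin m → ι | letterCount w = d}.ncard : ℝ) := by exact_mod_cast this
  linear_combination -f d' * h'

/-- Longer words have stochastically larger letter counts. -/
lemma sum_letterCount_mono [Fintype ι] {g : (ι → ℕ) → ℝ} (hg : Monotone g) (m k : ℕ) :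
    (Fintype.card ι : ℝ) ^ k * ∑ w : Fin m → ι, g (letterCount w) ≤
      ∑ w : Fin (m + k) → ι, g (letterCount w) := by
  classical
  induction k with
  | zero => simp
  | succ k ih =>
    rw [pow_succ', mul_assoc]
    refine (mul_le_mul_of_nonneg_left ih (Nat.cast_nonneg _)).trans ?_
    have hcons := (Fin.consEquiv fun _ : Fin (m + k + 1) => ι).sum_comp fun w => g (letterCount w)
    rw [Fintype.sum_prod_type] at hcons
    refine le_of_le_of_eq ?_ hcons
    rw [← nsmul_eq_mul, ← Finset.card_univ, ← Finset.sum_const]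
    refine Finset.sum_le_sum fun i _ => Finset.sum_le_sum fun w _ => hg ?_
    show letterCount w ≤ letterCount (Fin.cons i w : Fin (m + k + 1) → ι)
    rw [letterCount_cons]
    exact le_self_add

open Classical in
/-- The tail of one letter count, by a union bound over the positions of `t` occurrences. -/
lemma card_letterCount_ge [Fintype ι] (m t : ℕ) (i : ι) :
    (Finset.univ.filter fun w : Fin m → ι => t ≤ letterCount w i).card * Fintype.card ι ^ t ≤
      m.choose t * Fintype.card ι ^ m := by
  have h1 : (Finset.univ.filter fun w : Fin m → ι => t ≤ letterCount w i) ⊆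
      (Finset.univ.powersetCard t : Finset (Finset (Fin m))).biUnion fun J =>
        Fintype.piFinset fun j => if j ∈ J then {i} else Finset.univ := by
    intro w hw
    rw [Finset.mem_filter] at hw
    obtain ⟨J, hJ, hJt⟩ := Finset.exists_subset_card_eq hw.2
    refine Finset.mem_biUnion.2 ⟨J, Finset.mem_powersetCard.2 ⟨Finset.subset_univ _, hJt⟩, ?_⟩
    rw [Fintype.mem_piFinset]
    intro j
    by_cases hj : j ∈ J
    · rw [if_pos hj, Finset.mem_singleton]
      exact (Finset.mem_filter.1 (hJ hj)).2
    · rw [if_neg hj]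
      exact Finset.mem_univ _
  have h2 : ∀ J ∈ (Finset.univ.powersetCard t : Finset (Finset (Fin m))),
      (Fintype.piFinset fun j => if j ∈ J then ({i} : Finset ι) else Finset.univ).card *
        Fintype.card ι ^ t = Fintype.card ι ^ m := by
    intro J hJ
    have hJt := (Finset.mem_powersetCard.1 hJ).2
    have hle : t ≤ m := by
      rw [← hJt]
      simpa using Finset.card_le_univ J
    rw [Fintype.card_piFinset]
    have : ∀ j, (if j ∈ J then ({i} : Finset ι) else Finset.univ).card =
        if j ∈ J then 1 else Fintype.card ι := by
      intro j
      split_ifs <;> simp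
    simp only [this]
    rw [Finset.prod_ite, Finset.prod_const_one, one_mul, Finset.prod_const, ← pow_add]
    congr 1
    have h3 := Finset.card_filter_add_card_filter_not (s := (Finset.univ : Finset (Fin m)))
      (fun j => j ∈ J)
    rw [Finset.filter_univ_mem, Finset.card_univ, Fintype.card_fin, hJt] at h3
    omega
  calc _ ≤ (∑ J ∈ (Finset.univ.powersetCard t : Finset (Finset (Fin m))),
        (Fintype.piFinset fun j => if j ∈ J then ({i} : Finset ι) else Finset.univ).card) *
          Fintype.card ι ^ t :=
        Nat.mul_le_mul_right _ ((Finset.card_le_card h1).trans Finset.card_biUnion_le)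
    _ = m.choose t * Fintype.card ι ^ m := by
        rw [Finset.sum_mul, Finset.sum_congr rfl h2, Finset.sum_const, Finset.card_powersetCard,
          Finset.card_univ, Fintype.card_fin, smul_eq_mul]

lemma ExchangeRel.filter_sum_eq [Fintype ι] [DecidableEq ι] {S : Finset α} {e : α → ι → ℕ}
    (hex : ExchangeRel fun d => (S.filter fun a => e a = d).card) (m : ℕ) :
    ExchangeRel fun d => ((S.filter fun a => ∑ i, e a i = m).filter fun a => e a = d).card := by
  have key : ∀ d : ι → ℕ, ((S.filter fun a => ∑ i, e a i = m).filter fun a => e a = d).card =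
      if ∑ i, d i = m then (S.filter fun a => e a = d).card else 0 := by
    intro d
    split_ifs with h
    · congr 1
      ext a
      simp only [Finset.mem_filter]
      refine ⟨fun ha => ⟨ha.1.1, ha.2⟩, fun ha => ⟨⟨ha.1, ?_⟩, ha.2⟩⟩
      rw [ha.2, h]
    · rw [Finset.card_eq_zero, Finset.filter_eq_empty_iff]
      intro a ha had
      exact h (had ▸ (Finset.mem_filter.1 ha).2)
  intro u v huv d
  have hsum : ∀ w : ι, ∑ i, (d + Pi.single w 1 : ι → ℕ) i = ∑ i, d i + 1 := by
    intro w
    simp [Finset.sum_add_distrib]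
  simp only [key, hsum]
  split_ifs
  · exact hex u v huv d
  · simp

/-- A statistic with the exchange relation whose entries sum to at most `M` is stochastically at
most the vector of letter counts of a uniform word of length `M`. -/
lemma ExchangeRel.sum_le [Fintype ι] [DecidableEq ι] {S : Finset α} {e : α → ι → ℕ} {M : ℕ}
    (hM : ∀ a ∈ S, ∑ i, e a i ≤ M)
    (hex : ExchangeRel fun d => (S.filter fun a => e a = d).card) {f : (ι → ℕ) → ℝ}
    (hf : Monotone f) :
    (Fintype.card ι : ℝ) ^ M * ∑ a ∈ S, f (e a) ≤
      S.card * ∑ w : Fin M → ι, f (letterCount w) := by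
  have hmaps : ∀ a ∈ S, ∑ i, e a i ∈ Finset.range (M + 1) :=
    fun a ha => Finset.mem_range.2 (Nat.lt_succ_of_le (hM a ha))
  rw [← Finset.sum_fiberwise_of_maps_to hmaps, Finset.card_eq_sum_card_fiberwise hmaps,
    Nat.cast_sum, Finset.mul_sum, Finset.sum_mul]
  refine Finset.sum_le_sum fun m hm => ?_
  obtain ⟨k, rfl⟩ := Nat.exists_eq_add_of_le (Nat.lt_succ_iff.1 (Finset.mem_range.1 hm))
  have h := ExchangeRel.sum_eq _ e m (fun a ha => (Finset.mem_filter.1 ha).2)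
    (hex.filter_sum_eq m) f
  rw [pow_add, mul_right_comm, h, mul_assoc]
  refine mul_le_mul_of_nonneg_left ?_ (Nat.cast_nonneg _)
  rw [mul_comm]
  exact sum_letterCount_mono hf m k

/-- Tail bound for one entry, given the sum of the entries. -/
lemma ExchangeRel.card_ge_mul_le [Fintype ι] [DecidableEq ι] (S : Finset α) (e : α → ι → ℕ)
    (m : ℕ) (hm : ∀ a ∈ S, ∑ i, e a i = m)
    (hex : ExchangeRel fun d => (S.filter fun a => e a = d).card) (t : ℕ) (i : ι) :
    (S.filter fun a => t ≤ e a i).card * Fintype.card ι ^ t ≤ S.card * m.choose t := by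
  classical
  have h1 := ExchangeRel.sum_eq S e m hm hex fun d => if t ≤ d i then 1 else 0
  rw [Finset.sum_boole, Finset.sum_boole] at h1
  have h2 : Fintype.card ι ^ m * (S.filter fun a => t ≤ e a i).card =
      S.card * (Finset.univ.filter fun w : Fin m → ι => t ≤ letterCount w i).card := by
    exact_mod_cast h1
  have h3 := card_letterCount_ge m t i
  have hpos : 0 < Fintype.card ι ^ m := pow_pos (Fintype.card_pos_iff.2 ⟨i⟩) m
  refine Nat.le_of_mul_le_mul_left ?_ hpos
  rw [← mul_assoc, h2, mul_assoc]
  refine (Nat.mul_le_mul_left _ h3).trans (le_of_eq ?_)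
  ring

/-- Union bound over the entries: the expected number of entries that are at least `t` is at most
`1 / t!` times the expected sum of the entries. -/
lemma ExchangeRel.sum_card_ge_mul_factorial_le [Fintype ι] [DecidableEq ι] (S : Finset α)
    (e : α → ι → ℕ) (hM : ∀ a ∈ S, ∑ i, e a i ≤ Fintype.card ι)
    (hex : ExchangeRel fun d => (S.filter fun a => e a = d).card) {t : ℕ} (ht : 1 ≤ t) :
    (∑ i, (S.filter fun a => t ≤ e a i).card) * t.factorial ≤ ∑ a ∈ S, ∑ i, e a i := by
  have hmaps : ∀ a ∈ S, ∑ i, e a i ∈ Finset.range (Fintype.card ι + 1) :=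
    fun a ha => Finset.mem_range.2 (Nat.lt_succ_of_le (hM a ha))
  have hsplit : ∀ i, (S.filter fun a => t ≤ e a i).card =
      ∑ m ∈ Finset.range (Fintype.card ι + 1),
        ((S.filter fun a => ∑ i, e a i = m).filter fun a => t ≤ e a i).card := by
    intro i
    rw [Finset.card_eq_sum_card_fiberwise (f := fun a => ∑ i, e a i)
      fun a ha => hmaps a (Finset.mem_filter.1 ha).1]
    refine Finset.sum_congr rfl fun m _ => ?_
    rw [Finset.filter_comm]
  rw [← Finset.sum_fiberwise_of_maps_to hmaps]
  simp only [hsplit]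
  rw [Finset.sum_comm, Finset.sum_mul]
  refine Finset.sum_le_sum fun m hm => ?_
  have hmn : m ≤ Fintype.card ι := Nat.lt_succ_iff.1 (Finset.mem_range.1 hm)
  set Sm := S.filter fun a => ∑ i, e a i = m with hSm
  have hmem : ∀ a ∈ Sm, ∑ i, e a i = m := fun a ha => (Finset.mem_filter.1 ha).2
  rw [Finset.sum_congr rfl hmem, Finset.sum_const, smul_eq_mul, Finset.sum_mul]
  rcases Nat.eq_zero_or_pos (Fintype.card ι) with h0 | hpos
  · have := Fintype.card_eq_zero_iff.1 h0
    simp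
  have hbound : ∀ i ∈ (Finset.univ : Finset ι),
      (Sm.filter fun a => t ≤ e a i).card * t.factorial * Fintype.card ι ^ t ≤
        Sm.card * (m * Fintype.card ι ^ (t - 1)) := by
    intro i _
    calc (Sm.filter fun a => t ≤ e a i).card * t.factorial * Fintype.card ι ^ t
        = (Sm.filter fun a => t ≤ e a i).card * Fintype.card ι ^ t * t.factorial := by ring
      _ ≤ Sm.card * m.choose t * t.factorial :=
          Nat.mul_le_mul_right _ (ExchangeRel.card_ge_mul_le Sm e m hmem (hex.filter_sum_eq m) t i)
      _ = Sm.card * m.descFactorial t := by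
          rw [Nat.descFactorial_eq_factorial_mul_choose]; ring
      _ ≤ Sm.card * (m * Fintype.card ι ^ (t - 1)) := by
          refine Nat.mul_le_mul_left _ ((Nat.descFactorial_le_pow m t).trans ?_)
          obtain ⟨s, rfl⟩ := Nat.exists_eq_add_of_le' ht
          rw [pow_succ', Nat.add_sub_cancel]
          exact Nat.mul_le_mul_left _ (Nat.pow_le_pow_left hmn s)
  refine Nat.le_of_mul_le_mul_right (c := Fintype.card ι ^ t) ?_ (pow_pos hpos t)
  rw [Finset.sum_mul]
  refine (Finset.sum_le_sum hbound).trans (le_of_eq ?_)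
  rw [Finset.sum_const, Finset.card_univ, smul_eq_mul]
  obtain ⟨s, rfl⟩ := Nat.exists_eq_add_of_le' ht
  rw [pow_succ', Nat.add_sub_cancel]
  ring

end Words

namespace SimpleGraph

section Law

variable {V : Type}

/-! ### The law of the block-degrees in a family closed under moves -/

/-- The family `S` is closed under moving a branch within a component. -/
def MoveClosed (S : Set (SimpleGraph V)) : Prop :=
  ∀ G ∈ S, ∀ u v C, u ≠ v → G.Reachable u v → G.IsBranch u C → v ∉ C → G.moveBranch u v C ∈ S

/-- The excess block-degrees of the vertices of `W`. -/
noncomputable def excess (W : Finset V) (G : SimpleGraph V) (x : W) : ℕ := G.blockDegree x - 1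

lemma excess_add_one [Finite V] (W : Finset V) (G : SimpleGraph V) (x : W) :
    excess W G x + 1 = G.blockDegree x :=
  Nat.sub_add_cancel (blockDegree_pos _)

lemma excess_moveBranch [Finite V] [DecidableEq V] {W : Finset V} {G : SimpleGraph V} {u v : W}
    {C : Set V} (hC : G.IsBranch u C) (hv : (v : V) ∉ C) (huv : G.Reachable u v) (hne : u ≠ v)
    {d : W → ℕ} (hd : excess W G = d + Pi.single u 1) :
    excess W (G.moveBranch u v C) = d + Pi.single v 1 := by
  have hne' : (u : V) ≠ v := fun h => hne (Subtype.ext h)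
  ext x
  have hx := congrFun hd x
  have h1 := excess_add_one W G x
  have h2 := excess_add_one W (G.moveBranch u v C) x
  by_cases hxu : x = u
  · subst hxu
    have h3 := blockDegree_moveBranch_left hC hv huv hne'
    simp only [Pi.add_apply, Pi.single_eq_same, Pi.single_eq_of_ne hne] at hx ⊢
    omega
  by_cases hxv : x = v
  · subst hxv
    have h3 := blockDegree_moveBranch_right hC hv huv hne'
    simp only [Pi.add_apply, Pi.single_eq_same, Pi.single_eq_of_ne hxu] at hx ⊢
    omega
  · have h3 := blockDegree_moveBranch_of_ne hC hv huv hne' (x := x)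
      (fun h => hxu (Subtype.ext h)) (fun h => hxv (Subtype.ext h))
    simp only [Pi.add_apply, Pi.single_eq_of_ne hxu, Pi.single_eq_of_ne hxv] at hx ⊢
    omega

/-- The excess block-degrees within a fixed component satisfy the exchange relation. -/
lemma exchangeRel_excess [Finite V] [DecidableEq V] {W : Finset V} {S : Finset (SimpleGraph V)}
    (hW : ∀ G ∈ S, ∀ u ∈ W, ∀ v ∈ W, G.Reachable u v)
    (hS : ∀ G ∈ S, ∀ u ∈ W, ∀ v ∈ W, ∀ C, u ≠ v → G.IsBranch u C → v ∉ C →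
      G.moveBranch u v C ∈ S) :
    ExchangeRel fun d => (S.filter fun G => excess W G = d).card := by
  intro u v huv d
  have key : ∀ u v : W, u ≠ v → ∀ G ∈ ((S.filter fun G => excess W G = d + Pi.single u 1 :
      Finset (SimpleGraph V)) : Set (SimpleGraph V)), ∀ C, G.IsBranch u C → (v : V) ∉ C →
      G.moveBranch u v C ∈ ((S.filter fun G => excess W G = d + Pi.single v 1 :
      Finset (SimpleGraph V)) : Set (SimpleGraph V)) := by
    intro u v huv G hG C hC hv
    rw [Finset.mem_coe, Finset.mem_filter] at hG ⊢
    exact ⟨hS G hG.1 u u.2 v v.2 C (fun h => huv (Subtype.ext h)) hC hv,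
      excess_moveBranch hC hv (hW G hG.1 u u.2 v v.2) huv hG.2⟩
  have hdeg : ∀ u : W, ∀ G ∈ ((S.filter fun G => excess W G = d + Pi.single u 1 :
      Finset (SimpleGraph V)) : Set (SimpleGraph V)), G.blockDegree u = d u + 1 + 1 := by
    intro u G hG
    rw [Finset.mem_coe, Finset.mem_filter] at hG
    rw [← excess_add_one W G u, hG.2]
    simp
  have hreach : ∀ w : W, ∀ G ∈ ((S.filter fun G => excess W G = d + Pi.single w 1 :
      Finset (SimpleGraph V)) : Set (SimpleGraph V)), G.Reachable u v := by
    intro w G hG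
    rw [Finset.mem_coe, Finset.mem_filter] at hG
    exact hW G hG.1 u u.2 v v.2
  have := ncard_mul_eq_of_move (fun h => huv (Subtype.ext h)) (hreach u) (hreach v) (hdeg u)
    (hdeg v) (key u v huv) (key v u huv.symm)
  simpa only [Set.ncard_coe_finset] using this

open Classical in
/-- The sum over the components of the excess block-degrees bounds, up to `t!`, the number of graphs
with a block-degree above `t`. -/
lemma card_blockDegree_gt_mul_factorial_le [Fintype V] {S : Finset (SimpleGraph V)}
    (hS : MoveClosed (S : Set (SimpleGraph V))) {K : ℝ}
    (hK : ∀ G ∈ S, ((∑ W ∈ Finset.univ.filter G.IsComp,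
      ∑ x ∈ W, (G.blockDegree x - 1) : ℕ) : ℝ) ≤ K) {t : ℕ} (ht : 1 ≤ t) :
    ({G | G ∈ S ∧ ∃ v, t + 1 ≤ G.blockDegree v}.ncard : ℝ) * t.factorial ≤ S.card * K := by
  let SW : Finset V → Finset (SimpleGraph V) := fun W => S.filter fun G => G.IsComp W
  have h1 : {G | G ∈ S ∧ ∃ v, t + 1 ≤ G.blockDegree v}.ncard ≤
      ∑ W : Finset V, ∑ v : W, ((SW W).filter fun G => t ≤ excess W G v).card := by
    have hsub : {G | G ∈ S ∧ ∃ v, t + 1 ≤ G.blockDegree v} ⊆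
        (Finset.univ.biUnion fun W : Finset V => Finset.univ.biUnion fun v : W =>
          (SW W).filter fun G => t ≤ excess W G v : Finset (SimpleGraph V)) := by
      rintro G ⟨hG, v, hv⟩
      have hmem : ∀ x, x ∈ Finset.univ.filter (G.Reachable v) ↔ G.Reachable v x := by simp
      let W := Finset.univ.filter (G.Reachable v)
      have hvW : v ∈ W := (hmem v).2 (Reachable.refl v)
      have hW : G.IsComp W := ⟨⟨v, hvW⟩, fun r hr x => (hmem x).trans
        ⟨((hmem r).1 hr).symm.trans, ((hmem r).1 hr).trans⟩⟩
      refine Finset.mem_coe.2 (Finset.mem_biUnion.2 ⟨W, Finset.mem_univ _, Finset.mem_biUnion.2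
        ⟨⟨v, hvW⟩, Finset.mem_univ _, Finset.mem_filter.2 ⟨Finset.mem_filter.2 ⟨hG, hW⟩, ?_⟩⟩⟩)
      have := excess_add_one W G ⟨v, hvW⟩
      simp only at this
      omega
    refine (Set.ncard_le_ncard hsub).trans ?_
    rw [Set.ncard_coe_finset]
    exact Finset.card_biUnion_le.trans (Finset.sum_le_sum fun W _ => Finset.card_biUnion_le)
  have h2 : ∀ W : Finset V, (∑ v : W, ((SW W).filter fun G => t ≤ excess W G v).card) *
      t.factorial ≤ ∑ G ∈ SW W, ∑ x ∈ W, (G.blockDegree x - 1) := by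
    intro W
    have hsum : ∀ G, ∑ x : W, excess W G x = ∑ x ∈ W, (G.blockDegree x - 1) := fun G =>
      Finset.sum_coe_sort W fun x => G.blockDegree x - 1
    have := ExchangeRel.sum_card_ge_mul_factorial_le (SW W) (excess W) (fun G hG => by
        rw [hsum, Fintype.card_coe]
        exact sum_blockDegree_sub_one_le_card (Finset.mem_filter.1 hG).2)
      (exchangeRel_excess (fun G hG u hu v hv => ((Finset.mem_filter.1 hG).2.2 u hu v).1 hv) ?_) ht
    · simpa only [hsum] using this
    · intro G hG u hu v hv C hne hC hvC
      obtain ⟨hGS, hGW⟩ := Finset.mem_filter.1 hG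
      have huv := (hGW.2 u hu v).1 hv
      refine Finset.mem_filter.2 ⟨hS G hGS u v C hne huv hC hvC, hGW.1, fun r hr x => ?_⟩
      rw [hGW.2 r hr, reachable_moveBranch_iff hC hvC huv]
  have h3 : ∑ W : Finset V, ∑ G ∈ SW W, ∑ x ∈ W, (G.blockDegree x - 1) =
      ∑ G ∈ S, ∑ W ∈ Finset.univ.filter G.IsComp, ∑ x ∈ W, (G.blockDegree x - 1) := by
    simp only [SW, Finset.sum_filter]
    exact Finset.sum_comm
  have h4 : {G | G ∈ S ∧ ∃ v, t + 1 ≤ G.blockDegree v}.ncard * t.factorial ≤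
      ∑ G ∈ S, ∑ W ∈ Finset.univ.filter G.IsComp, ∑ x ∈ W, (G.blockDegree x - 1) := by
    rw [← h3]
    refine (Nat.mul_le_mul_right _ h1).trans ?_
    rw [Finset.sum_mul]
    exact Finset.sum_le_sum fun W _ => h2 W
  calc ({G | G ∈ S ∧ ∃ v, t + 1 ≤ G.blockDegree v}.ncard : ℝ) * t.factorial
      ≤ ∑ G ∈ S, ((∑ W ∈ Finset.univ.filter G.IsComp,
          ∑ x ∈ W, (G.blockDegree x - 1) : ℕ) : ℝ) := by
        exact_mod_cast h4
    _ ≤ ∑ G ∈ S, K := Finset.sum_le_sum hK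
    _ = S.card * K := by rw [Finset.sum_const, nsmul_eq_mul]

/-! ### Trees -/

lemma isAcyclic_iff_ncard_le_two [Finite V] {G : SimpleGraph V} :
    G.IsAcyclic ↔ ∀ S ∈ G.blockSets, S.ncard ≤ 2 := by
  rw [isAcyclic_iff_forall_adj_isBridge]
  constructor
  · intro h S hS
    by_contra! h3
    obtain ⟨a, ha⟩ := hS.1.1
    obtain ⟨b, hb, hba⟩ := Set.exists_ne_of_one_lt_ncard (by omega : 1 < S.ncard) a
    obtain ⟨c, hc, hac⟩ := hS.1.2.1.exists_adj ha hb hba.symm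
    have := ((h hac).pair_mem_blockSets hac).eq_of_subset hS.1 (by
      rintro x (rfl | rfl)
      exacts [ha, hc])
    rw [← this, Set.ncard_pair hac.ne] at h3
    omega
  · intro h u v huv
    obtain ⟨B, hB, hsub⟩ := (isNonsep_pair huv).exists_blockSet
    have : {u, v} = B := Set.eq_of_subset_of_ncard_le hsub (by
      rw [Set.ncard_pair huv.ne]; exact h B hB)
    exact isBridge_of_pair_mem_blockSets huv (this ▸ hB)

lemma ncard_moveSet (u v : V) (C S : Set V) : (moveSet u v C S).ncard = S.ncard := by
  classical
  by_cases h : (S ∩ C).Nonempty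
  · rw [moveSet_of_nonempty h, Set.ncard_image_of_injective _ (Equiv.injective _)]
  · rw [moveSet_of_not_nonempty h]

lemma moveClosed_isTree [Finite V] : MoveClosed {T : SimpleGraph V | T.IsTree} := by
  intro T hT u v C hne huv hC hv
  refine ⟨(connected_iff _).2 ⟨fun a b => ?_, ((connected_iff _).1 hT.connected).2⟩, ?_⟩
  · exact (reachable_moveBranch_iff hC hv huv).2 (hT.connected.preconnected a b)
  · rw [isAcyclic_iff_ncard_le_two]
    intro S hS
    rw [← moveSet_moveSet hv hC.1 S, moveSet_mem_blockSets_iff hC hv huv hne] at hS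
    rw [← ncard_moveSet v u C]
    exact isAcyclic_iff_ncard_le_two.1 hT.isAcyclic _ hS

/-- In a tree the blocks are the edges. -/
lemma IsTree.blockDegree_eq_degree [Finite V] {T : SimpleGraph V} (hT : T.IsTree) {v : V}
    [Fintype (T.neighborSet v)] (hV : Nontrivial V) : T.blockDegree v = T.degree v := by
  obtain ⟨w, hw⟩ := exists_ne v
  obtain ⟨C, ⟨-, -, -, c, -, hvc⟩, -⟩ :=
    exists_isBranch_mem (hT.connected.preconnected v w) hw.symm
  rw [blockDegree_eq, ← card_neighborSet_eq_degree, ← Nat.card_eq_fintype_card]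
  symm
  refine Set.ncard_congr (s := T.neighborSet v) (fun w _ => {v, w}) ?_ ?_ ?_
  · exact fun w hw => ⟨IsBridge.pair_mem_blockSets hw
      (isAcyclic_iff_forall_adj_isBridge.1 hT.isAcyclic hw), Or.inl rfl⟩
  · intro a b ha hb h
    have : a ∈ ({v, b} : Set V) := h ▸ Or.inr rfl
    exact this.resolve_left (Adj.ne' ha)
  · rintro S ⟨hS, hv⟩
    obtain ⟨x, hx, hxv⟩ := exists_mem_blockSets_ne hvc hS
    obtain ⟨y, hy, hvy⟩ := hS.1.2.1.exists_adj hv hx hxv.symm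
    refine ⟨y, hvy, Set.eq_of_subset_of_ncard_le ?_ ?_⟩
    · rintro z (rfl | rfl)
      exacts [hv, hy]
    · rw [Set.ncard_pair hvy.ne]
      exact isAcyclic_iff_ncard_le_two.1 hT.isAcyclic S hS

lemma IsTree.sum_blockDegree_sub_one [Fintype V] {T : SimpleGraph V} (hT : T.IsTree)
    (hV : Nontrivial V) : ∑ v, (T.blockDegree v - 1) + 2 = Fintype.card V := by
  classical
  have h1 := T.sum_degrees_eq_twice_card_edges
  have h2 := hT.card_edgeFinset
  have h3 : ∑ v, (T.blockDegree v - 1) + Fintype.card V = ∑ v, T.degree v := by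
    rw [← Finset.card_univ, Finset.card_eq_sum_ones, ← Finset.sum_add_distrib]
    refine Finset.sum_congr rfl fun v _ => ?_
    rw [Nat.sub_add_cancel (blockDegree_pos v), hT.blockDegree_eq_degree hV]
  omega

end Law

end SimpleGraph

/-! ### Uniform elements of a weakly block-stable class -/

section Classes

open SimpleGraph

lemma GraphClass.IsWeaklyBlockStable.moveClosed {A : GraphClass} (hA : A.IsWeaklyBlockStable)
    (n : ℕ) : MoveClosed (A.on n) := fun G hG _ _ _ hne huv hC hv =>
  hA G _ hG (blockEquiv_moveBranch hC hv huv hne)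

lemma GraphClass.IsWeaklyBlockStable.moveClosed_connectedPart {A : GraphClass}
    (hA : A.IsWeaklyBlockStable) (n : ℕ) : MoveClosed (A.connectedPart.on n) := by
  rintro G ⟨hG, hconn⟩ u v C hne huv hC hv
  refine ⟨hA.moveClosed n G hG u v C hne huv hC hv,
    (connected_iff _).2 ⟨fun a b => ?_, ((connected_iff _).1 hconn).2⟩⟩
  exact (reachable_moveBranch_iff hC hv huv).2 (hconn.preconnected a b)

lemma SimpleGraph.isComp_univ {V : Type} [Fintype V] {G : SimpleGraph V} (hG : G.Connected) :
    G.IsComp Finset.univ := by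
  obtain ⟨x⟩ := ((connected_iff _).1 hG).2
  exact ⟨⟨x, Finset.mem_univ x⟩, fun r _ x => by simp [hG.preconnected r x]⟩

lemma unifExp_eq_sum {α : Type} [Finite α] (S : Finset α) (f : α → ℝ) :
    unifExp (S : Set α) f = (∑ x ∈ S, f x) / S.card := by
  rw [unifExp, finsum_mem_coe_finset, Set.ncard_coe_finset]

lemma unifProb_eq_unifExp {α : Type} [Finite α] (S : Set α) (E : α → Prop) [DecidablePred E] :
    unifProb S E = unifExp S fun x => if E x then 1 else 0 := by
  classical
  have := Fintype.ofFinite α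
  have hS : S = (S.toFinset : Set α) := by simp
  rw [hS, unifExp_eq_sum, unifProb, Finset.sum_boole, Set.ncard_coe_finset]
  congr 2
  rw [← Set.ncard_coe_finset]
  congr 1
  ext
  simp

/-- Vector domination implies domination of the maxima of the entries. -/
lemma StochLEVec.stochLE_of_le_iff {α β ι : Type} [Finite α] [Finite β] {S : Set α} {T : Set β}
    {X : α → ι → ℝ} {Y : β → ι → ℝ} (h : StochLEVec S X T Y) {X' : α → ℝ} {Y' : β → ℝ}
    (hX : ∀ a t, t ≤ X' a ↔ ∃ i, t ≤ X a i) (hY : ∀ b t, t ≤ Y' b ↔ ∃ i, t ≤ Y b i) :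
    StochLE S X' T Y' := by
  classical
  intro t
  simp only [hX, hY, unifProb_eq_unifExp]
  refine h (fun x => if ∃ i, t ≤ x i then 1 else 0) fun x y hxy => ?_
  by_cases hx : ∃ i, t ≤ x i
  · obtain ⟨i, hi⟩ := hx
    simp only [if_pos (⟨i, hi⟩ : ∃ i, t ≤ x i), if_pos (⟨i, hi.trans (hxy i)⟩ : ∃ i, t ≤ y i),
      le_refl]
  · simp only [if_neg hx]
    split_ifs <;> norm_num

lemma le_maxBlockDegree_iff {n : ℕ} (hn : 2 ≤ n) (G : SimpleGraph (Fin n)) (t : ℝ) :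
    t ≤ (G.maxBlockDegree : ℝ) ↔ ∃ v, t ≤ G.blockDegreeSeq v := by
  constructor
  · intro h
    obtain ⟨v, -, hv⟩ := Finset.exists_mem_eq_sup (Finset.univ : Finset (Fin n))
      ⟨⟨0, by omega⟩, Finset.mem_univ _⟩ G.blockDegree
    exact ⟨v, by rwa [maxBlockDegree, hv] at h⟩
  · rintro ⟨v, hv⟩
    refine hv.trans ?_
    exact Nat.cast_le.2 (Finset.le_sup (f := G.blockDegree) (Finset.mem_univ v))

lemma le_maxDegreeReal_iff {n : ℕ} (hn : 2 ≤ n) (G : SimpleGraph (Fin n)) (t : ℝ) :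
    t ≤ G.maxDegreeReal ↔ ∃ v, t ≤ G.degreeSeq v := by
  classical
  constructor
  · intro h
    have : Nonempty (Fin n) := ⟨⟨0, by omega⟩⟩
    obtain ⟨v, hv⟩ := G.exists_maximal_degree_vertex
    refine ⟨v, h.trans (le_of_eq ?_)⟩
    rw [maxDegreeReal, degreeSeq]
    exact_mod_cast (by convert hv)
  · rintro ⟨v, hv⟩
    refine hv.trans ?_
    rw [maxDegreeReal, degreeSeq]
    exact_mod_cast G.degree_le_maxDegree v

lemma treesOn_nonempty {n : ℕ} (hn : 2 ≤ n) : (treesOn n).Nonempty := by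
  have : Nonempty (Fin n) := ⟨⟨0, by omega⟩⟩
  obtain ⟨T, -, hT⟩ := (connected_top (V := Fin n)).exists_isTree_le
  exact ⟨T, hT⟩

/-- Given the number of its blocks, the excess block-degrees of a random connected graph are the
letter counts of a uniform word; for a tree this word has the maximal length `n - 2`. -/
lemma stochLEVec_blockDegreeSeq {A : GraphClass} (hA : A.IsWeaklyBlockStable) {n : ℕ} (hn : 2 ≤ n)
    (hne : (A.connectedPart.on n).Nonempty) :
    StochLEVec (A.connectedPart.on n) (fun G => G.blockDegreeSeq)
      (treesOn n) (fun T => T.degreeSeq) := by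
  classical
  intro f hf
  let W : Finset (Fin n) := Finset.univ
  have hnt : Nontrivial (Fin n) := Fin.nontrivial_iff_two_le.2 hn
  have hcard : W.card = n := by simp [W]
  let g : (W → ℕ) → ℝ := fun d => f fun v => ((d ⟨v, Finset.mem_univ v⟩ + 1 : ℕ) : ℝ)
  have hg : Monotone g := by
    intro d d' hd
    refine hf fun v => ?_
    exact Nat.cast_le.2 (Nat.succ_le_succ (hd _))
  have hgX : ∀ G : SimpleGraph (Fin n), f G.blockDegreeSeq = g (excess W G) := by
    intro G
    refine congrArg f (funext fun v => ?_)
    rw [excess_add_one, blockDegreeSeq]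
  have hgT : ∀ T ∈ treesOn n, f T.degreeSeq = g (excess W T) := by
    intro T hT
    rw [← hgX T]
    refine congrArg f (funext fun v => ?_)
    rw [blockDegreeSeq, degreeSeq, IsTree.blockDegree_eq_degree hT hnt]
  have hsum : ∀ G : SimpleGraph (Fin n), ∑ x, excess W G x = ∑ x ∈ W, (G.blockDegree x - 1) :=
    fun G => Finset.sum_coe_sort W fun x => G.blockDegree x - 1
  have hex : ∀ S : Finset (SimpleGraph (Fin n)), (∀ G ∈ S, G.Connected) →
      MoveClosed (S : Set (SimpleGraph (Fin n))) →
      ExchangeRel fun d => (S.filter fun G => excess W G = d).card := by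
    intro S hconn hmove
    refine exchangeRel_excess (fun G hG u _ v _ => (hconn G hG).preconnected u v) ?_
    exact fun G hG u _ v _ C hne hC hv =>
      hmove G hG u v C hne ((hconn G hG).preconnected u v) hC hv
  have hWcard : (Fintype.card W : ℝ) = n := by rw [Fintype.card_coe, hcard]
  have hn0 : (0 : ℝ) < (n : ℝ) ^ (n - 2) := pow_pos (by exact_mod_cast (by omega : 0 < n)) _
  obtain ⟨S, hS⟩ : ∃ S : Finset (SimpleGraph (Fin n)), (S : Set _) = A.connectedPart.on n :=
    ⟨(A.connectedPart.on n).toFinset, by simp⟩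
  obtain ⟨T, hT⟩ : ∃ T : Finset (SimpleGraph (Fin n)), (T : Set _) = treesOn n :=
    ⟨(treesOn n).toFinset, by simp⟩
  have hSc : ∀ G ∈ S, G.Connected := fun G hG =>
    (hS ▸ Finset.mem_coe.2 hG : G ∈ A.connectedPart.on n).2
  have hTt : ∀ G ∈ T, G.IsTree := fun G hG => (hT ▸ Finset.mem_coe.2 hG : G ∈ treesOn n)
  have hSpos : (0 : ℝ) < S.card := by
    rw [← hS] at hne
    exact_mod_cast Finset.card_pos.2 (Finset.coe_nonempty.1 hne)
  have hTpos : (0 : ℝ) < T.card := by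
    have := treesOn_nonempty hn
    rw [← hT] at this
    exact_mod_cast Finset.card_pos.2 (Finset.coe_nonempty.1 this)
  have h1 := ExchangeRel.sum_le (S := S) (e := excess W) (M := n - 2) (fun G hG => by
      have := sum_blockDegree_sub_one_le (isComp_univ (hSc G hG)) (by rw [hcard]; exact hn)
      rw [hsum]
      change ∑ x ∈ W, (G.blockDegree x - 1) + 2 ≤ W.card at this
      omega) (hex S hSc (hS ▸ hA.moveClosed_connectedPart n)) hg
  have h2 := ExchangeRel.sum_eq T (excess W) (n - 2) (fun G hG => by
      have := (hTt G hG).sum_blockDegree_sub_one hnt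
      rw [hsum]
      rw [Fintype.card_fin] at this
      change ∑ x ∈ W, (G.blockDegree x - 1) + 2 = n at this
      omega) (hex T (fun G hG => (hTt G hG).connected) (hT ▸ moveClosed_isTree)) g
  rw [hWcard] at h1 h2
  rw [← hS, ← hT, unifExp_eq_sum, unifExp_eq_sum, Finset.sum_congr rfl fun G _ => hgX G,
    Finset.sum_congr rfl fun G hG => hgT G (hTt G hG), div_le_div_iff₀ hSpos hTpos]
  refine le_of_mul_le_mul_left ?_ hn0
  calc (n : ℝ) ^ (n - 2) * ((∑ G ∈ S, g (excess W G)) * T.card)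
      = ((n : ℝ) ^ (n - 2) * ∑ G ∈ S, g (excess W G)) * T.card := by ring
    _ ≤ (S.card * ∑ w : Fin (n - 2) → W, g (letterCount w)) * T.card :=
        mul_le_mul_of_nonneg_right h1 hTpos.le
    _ = S.card * (T.card * ∑ w : Fin (n - 2) → W, g (letterCount w)) := by ring
    _ = (n : ℝ) ^ (n - 2) * ((∑ G ∈ T, g (excess W G)) * S.card) := by rw [← h2]; ring

lemma lt_maxBlockDegree_iff {n t : ℕ} (G : SimpleGraph (Fin n)) :
    t < G.maxBlockDegree ↔ ∃ v, t + 1 ≤ G.blockDegree v := by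
  simp [maxBlockDegree, Finset.lt_sup_iff]

/-- The basic tail bound for graphs with at most `K` blocks. -/
lemma unifProb_lt_maxBlockDegree_le {A : GraphClass} (hA : A.IsWeaklyBlockStable) {n : ℕ}
    (hne : (A.on n).Nonempty) {K : ℝ} (hK : n ≤ K ∨ ∀ G ∈ A.on n, (G.numBlocks : ℝ) ≤ K) {t : ℕ}
    (ht : 1 ≤ t) : unifProb (A.on n) (fun G => t < G.maxBlockDegree) ≤ K / t.factorial := by
  classical
  obtain ⟨S, hS⟩ : ∃ S : Finset (SimpleGraph (Fin n)), (S : Set _) = A.on n :=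
    ⟨(A.on n).toFinset, by simp⟩
  have hmem : ∀ G, G ∈ A.on n ↔ G ∈ S := fun G => by rw [← hS, Finset.mem_coe]
  have hSpos : (0 : ℝ) < S.card := by
    rw [← hS] at hne
    exact_mod_cast Finset.card_pos.2 (Finset.coe_nonempty.1 hne)
  have h := card_blockDegree_gt_mul_factorial_le (S := S) (K := K) (hS ▸ hA.moveClosed n)
    (fun G hG => by
      rcases hK with hK | hK
      · refine le_trans ?_ hK
        have := sum_isComp_blockDegree_le_card (G := G)
        rw [Fintype.card_fin] at this
        exact_mod_cast this
      · refine le_trans ?_ (hK G ((hmem G).2 hG))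
        exact_mod_cast sum_isComp_blockDegree_le_numBlocks (G := G)) ht
  simp only [unifProb, lt_maxBlockDegree_iff, hmem]
  rw [← hS, Set.ncard_coe_finset, div_le_div_iff₀ hSpos (by exact_mod_cast t.factorial_pos),
    mul_comm K]
  exact h

lemma unifProb_mono {α : Type} [Finite α] {S : Set α} {E F : α → Prop}
    (h : ∀ x ∈ S, E x → F x) : unifProb S E ≤ unifProb S F := by
  refine div_le_div_of_nonneg_right ?_ (Nat.cast_nonneg _)
  exact Nat.cast_le.2 (Set.ncard_le_ncard fun x hx => ⟨hx.1, h x hx.1 hx.2⟩)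

lemma unifProb_not {α : Type} [Finite α] {S : Set α} (hS : S.Nonempty) (E : α → Prop) :
    unifProb S (fun x => ¬ E x) = 1 - unifProb S E := by
  have hpos : (0 : ℝ) < S.ncard := by exact_mod_cast (Set.ncard_pos).2 hS
  have h : {x ∈ S | E x}.ncard + {x ∈ S | ¬ E x}.ncard = S.ncard :=
    Set.ncard_inter_add_ncard_sdiff_eq_ncard S {x | E x}
  rw [unifProb, unifProb, eq_sub_iff_add_eq, ← add_div, div_eq_one_iff_eq hpos.ne', add_comm]
  exact_mod_cast h

lemma unifProb_nonneg {α : Type} (S : Set α) (E : α → Prop) : 0 ≤ unifProb S E :=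
  div_nonneg (Nat.cast_nonneg _) (Nat.cast_nonneg _)

end Classes

/-! ### Asymptotic estimates -/

section Estimates

open Real

/-- A lower bound for factorials, from `s ^ (t + 1) / (t + 1)! ≤ exp s`. -/
lemma one_div_factorial_le {s : ℝ} {t : ℕ} (hs : 1 ≤ s) (hst : s ≤ t + 1) :
    1 / (t.factorial : ℝ) ≤ (t + 1) * exp (s - s * log s) := by
  have hs0 : 0 < s := by linarith
  have h1 := pow_div_factorial_le_exp s hs0.le (t + 1)
  have h2 : exp (s * log s) ≤ s ^ (t + 1) := by
    rw [← exp_log (pow_pos hs0 (t + 1)), log_pow, exp_le_exp]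
    push_cast
    exact mul_le_mul_of_nonneg_right hst (log_nonneg hs)
  have ht : (0 : ℝ) < t.factorial := by exact_mod_cast t.factorial_pos
  have ht1 : (0 : ℝ) < t + 1 := by positivity
  rw [Nat.factorial_succ, Nat.cast_mul, Nat.cast_succ, div_le_iff₀ (by positivity)] at h1
  rw [exp_sub, div_le_iff₀ ht, mul_div_assoc', div_mul_eq_mul_div, le_div_iff₀ (exp_pos _), one_mul]
  calc exp (s * log s) ≤ exp s * ((t + 1) * t.factorial) := h2.trans h1
    _ = (t + 1) * exp s * t.factorial := by ring

lemma eventually_log_sq_le {c : ℝ} (hc : 0 < c) : ∀ᶠ x : ℝ in atTop, log x ^ 2 ≤ c * x := by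
  filter_upwards [(isLittleO_pow_log_id_atTop (n := 2)).bound hc, eventually_ge_atTop 0]
    with x hx h0
  simpa [abs_of_nonneg h0] using hx

lemma tendsto_epsFn : Tendsto epsFn atTop (𝓝 0) := by
  have h := (isLittleO_log_id_atTop.tendsto_div_nhds_zero.comp
    (tendsto_log_atTop.comp tendsto_log_atTop)).const_mul 2
  rw [mul_zero] at h
  refine h.congr fun x => ?_
  simp [epsFn, mul_div_assoc]

lemma tendsto_etaFn : Tendsto etaFn atTop (𝓝 0) := by
  have h := (isLittleO_log_id_atTop.tendsto_div_nhds_zero.comp tendsto_log_atTop).const_mul 2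
  rw [mul_zero] at h
  refine h.congr fun x => ?_
  simp [etaFn, mul_div_assoc]

/-- With `y = log x`, `L = log y`, `M = log L` and `D = degreeBound x`, the exponent `D log D - D`
is at least `y + y / L`, which beats the factor `x = exp y`. -/
lemma eventually_div_factorial_le : ∀ᶠ x : ℝ in atTop,
    1 ≤ ⌊degreeBound x⌋₊ ∧ x / (⌊degreeBound x⌋₊.factorial : ℝ) ≤ exp (-log (log x)) := by
  have hlog2 : Tendsto (fun x => log (log x)) atTop atTop :=
    tendsto_log_atTop.comp tendsto_log_atTop
  filter_upwards [eventually_gt_atTop 0, tendsto_log_atTop.eventually_ge_atTop 2,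
    tendsto_log_atTop.eventually (eventually_log_sq_le (c := 1 / 2) (by norm_num)),
    hlog2.eventually_ge_atTop 4, hlog2.eventually (eventually_log_sq_le (c := 1 / 4) (by norm_num)),
    (tendsto_log_atTop.comp hlog2).eventually_ge_atTop 3] with x hx hy2 hyL hL4 hLM hM
  simp only [Function.comp_apply] at hM
  set D := degreeBound x with hD
  have hDdef : D = (1 + 2 * log (log (log x)) / log (log x)) * log x / log (log x) := rfl
  set y := log x
  set L := log y
  set M := log L
  have hL0 : 0 < L := by linarith
  have hy0 : 0 < y := by linarith
  have h2M : 2 * M ≤ L := by nlinarith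
  have hyL' : L * (2 * L) ≤ y := by nlinarith
  have hMM : 2 * M * (M + 1) / L ≤ 1 := by
    rw [div_le_one hL0]
    nlinarith
  have hfac1 : 1 ≤ 1 + 2 * M / L := by
    have : 0 ≤ 2 * M / L := by positivity
    linarith
  have hfac2 : 1 + 2 * M / L ≤ 2 := by
    have : 2 * M / L ≤ 1 := (div_le_one hL0).2 h2M
    linarith
  have hD' : D = (1 + 2 * M / L) * (y / L) := by rw [hDdef, mul_div_assoc]
  have hyLpos : 0 < y / L := by positivity
  have hDlow : y / L ≤ D := by rw [hD']; nlinarith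
  have hyL2 : 2 * L ≤ y / L := by rw [le_div_iff₀ hL0]; linarith
  have hDup : D + 1 ≤ y := by
    have : y / L ≤ y / 4 := div_le_div_of_nonneg_left hy0.le (by norm_num) hL4
    rw [hD']
    nlinarith
  have hD1 : 1 ≤ D := by linarith
  have hD0 : 0 < D := by linarith
  have hfloor : (⌊D⌋₊ : ℝ) ≤ D := Nat.floor_le hD0.le
  refine ⟨Nat.le_floor (by exact_mod_cast hD1), ?_⟩
  have hlogD : L - M ≤ log D := by
    rw [← log_div hy0.ne' hL0.ne']
    exact log_le_log hyLpos hDlow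
  have hkey : y + y / L ≤ D * log D - D := by
    have h1 : L + 1 ≤ (1 + 2 * M / L) * (L - M - 1) := by
      have : (1 + 2 * M / L) * (L - M - 1) = L - M - 1 + 2 * M - 2 * M * (M + 1) / L := by
        field_simp
        ring
      rw [this]
      linarith
    have h2 : y + y / L = (y / L) * (L + 1) := by
      field_simp
    calc y + y / L = (y / L) * (L + 1) := h2
      _ ≤ (y / L) * ((1 + 2 * M / L) * (L - M - 1)) := mul_le_mul_of_nonneg_left h1 hyLpos.le
      _ = D * (L - M - 1) := by rw [hD']; ring
      _ ≤ D * (log D - 1) := mul_le_mul_of_nonneg_left (by linarith) hD0.le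
      _ = D * log D - D := by ring
  have hfac := one_div_factorial_le (t := ⌊D⌋₊) hD1 (Nat.lt_floor_add_one D).le
  calc x / (⌊D⌋₊.factorial : ℝ) = x * (1 / (⌊D⌋₊.factorial : ℝ)) := by ring
    _ ≤ x * ((⌊D⌋₊ + 1) * exp (D - D * log D)) := mul_le_mul_of_nonneg_left hfac hx.le
    _ ≤ exp y * (y * exp (-(y + y / L))) := by
        rw [exp_log hx]
        refine mul_le_mul_of_nonneg_left (mul_le_mul (by linarith) (exp_le_exp.2 (by linarith))
          (exp_pos _).le hy0.le) hx.le
    _ = exp y * (exp L * exp (-(y + y / L))) := by rw [exp_log hy0]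
    _ = exp (L - y / L) := by rw [← exp_add, ← exp_add]; congr 1; ring
    _ ≤ exp (-L) := exp_le_exp.2 (by linarith)

/-- The estimate for the large deviations: with `s = c n / log n` the exponent `s log s - s` exceeds
`(1 - η(n)) c n` by at least `2 log n`. -/
lemma eventually_large_deviation {c : ℝ} (hc : 0 < c) : ∀ᶠ x : ℝ in atTop,
    2 ≤ c * x / log x ∧ c * x / log x + 1 ≤ x ∧
      x * (x * exp (c * x / log x - c * x / log x * log (c * x / log x))) ≤
        exp (-((1 - etaFn x) * c * x)) := by
  filter_upwards [eventually_ge_atTop 2, tendsto_log_atTop.eventually_ge_atTop 1,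
    tendsto_log_atTop.eventually_ge_atTop (2 * c), eventually_log_sq_le (c := c / 2) (by linarith),
    (tendsto_log_atTop.comp tendsto_log_atTop).eventually_ge_atTop (2 - log c)]
    with x hx hy1 hyc hyx hL
  simp only [Function.comp_apply] at hL
  have hx0 : 0 < x := by linarith
  have hy0 : 0 < log x := by linarith
  set s := c * x / log x with hs
  have hsy : s * log x = c * x := div_mul_cancel₀ _ hy0.ne'
  have hs2 : 2 * log x ≤ s := by
    rw [hs, le_div_iff₀ hy0]
    nlinarith
  have hs0 : 0 < s := by linarith
  have hlogs : log s = log c + log x - log (log x) := by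
    rw [hs, log_div (mul_pos hc hx0).ne' hy0.ne', log_mul hc.ne' hx0.ne']
  refine ⟨by linarith, ?_, ?_⟩
  · have : s ≤ x / 2 := by
      rw [hs, div_le_iff₀ hy0]
      nlinarith
    linarith
  · have heta : (1 - etaFn x) * c * x = c * x - 2 * log (log x) * s := by
      rw [etaFn, hs]
      ring
    have hexp : x * (x * exp (s - s * log s)) = exp (2 * log x + (s - s * log s)) := by
      rw [exp_add, two_mul, exp_add, exp_log hx0, mul_assoc]
    rw [hexp, heta, exp_le_exp, hlogs]
    have h1 : s * (2 - log c) ≤ s * log (log x) := mul_le_mul_of_nonneg_left hL hs0.le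
    nlinarith

end Estimates

/-! ### The maximum block-degree of a random graph -/

section MaxBlockDegree

open SimpleGraph

/-- The bound on the maximum block-degree in terms of `k n`, a bound on the number of vertices or on
the number of blocks. -/
lemma tendsto_unifProb_maxBlockDegree_le {A : GraphClass} (hA : A.IsWeaklyBlockStable)
    {k : ℕ → ℝ} (hk : Tendsto k A.sizes atTop)
    (hK : ∀ n : ℕ, 1 ≤ n → (n : ℝ) ≤ k n ∨ ∀ G ∈ A.on n, (G.numBlocks : ℝ) ≤ k n) :
    Tendsto (fun n : ℕ => unifProb (A.on n)
      (fun G => (G.maxBlockDegree : ℝ) ≤ degreeBound (k n))) A.sizes (𝓝 1) := by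
  have hlim : Tendsto (fun n => 1 - Real.exp (-Real.log (Real.log (k n)))) A.sizes (𝓝 1) := by
    have := (Real.tendsto_exp_neg_atTop_nhds_zero.comp
      ((Real.tendsto_log_atTop.comp Real.tendsto_log_atTop).comp hk)).const_sub 1
    rwa [sub_zero] at this
  have hmem : ∀ᶠ n in A.sizes, (A.on n).Nonempty :=
    mem_inf_of_right (mem_principal_self _)
  have hge : ∀ᶠ n in A.sizes, 1 ≤ n := mem_inf_of_left (eventually_ge_atTop 1)
  refine tendsto_of_tendsto_of_tendsto_of_le_of_le' hlim tendsto_const_nhds ?_ ?_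
  · filter_upwards [hmem, hge, hk.eventually eventually_div_factorial_le] with n hne hn ⟨ht, hle⟩
    have hD : 0 ≤ degreeBound (k n) := by
      by_contra! h
      rw [Nat.floor_of_nonpos h.le] at ht
      omega
    have h1 := unifProb_lt_maxBlockDegree_le hA hne (hK n hn) ht
    have h2 : unifProb (A.on n) (fun G => ¬ (G.maxBlockDegree : ℝ) ≤ degreeBound (k n)) ≤
        unifProb (A.on n) (fun G => ⌊degreeBound (k n)⌋₊ < G.maxBlockDegree) :=
      unifProb_mono fun G _ hG => (Nat.floor_lt hD).2 (not_le.1 hG)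
    rw [unifProb_not hne] at h2
    linarith
  · filter_upwards [hmem] with n hne
    have h1 := unifProb_nonneg (A.on n) fun G => ¬ (G.maxBlockDegree : ℝ) ≤ degreeBound (k n)
    rw [unifProb_not hne] at h1
    linarith

lemma exists_forall_unifProb_large_deviation_le (c : ℝ) (hc : 0 < c) :
    ∃ N : ℕ, ∀ A : GraphClass, A.IsWeaklyBlockStable → ∀ n : ℕ, N ≤ n → (A.on n).Nonempty →
      unifProb (A.on n) (fun G => c * (n : ℝ) / Real.log (n : ℝ) ≤ (G.maxBlockDegree : ℝ)) ≤
        Real.exp (-((1 - etaFn (n : ℝ)) * c * (n : ℝ))) := by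
  obtain ⟨N, hN⟩ := eventually_atTop.1
    (tendsto_natCast_atTop_atTop.eventually (eventually_large_deviation hc))
  refine ⟨N, fun A hA n hn hne => ?_⟩
  obtain ⟨h2, hsn, hexp⟩ := hN n hn
  set s := c * (n : ℝ) / Real.log n with hs
  obtain ⟨t, ht⟩ : ∃ t, ⌈s⌉₊ = t + 1 :=
    Nat.exists_eq_succ_of_ne_zero (Nat.ceil_pos.2 (by linarith)).ne'
  have hst : s ≤ t + 1 := by
    have := Nat.le_ceil s
    rw [ht] at this
    exact_mod_cast this
  have hts : (t : ℝ) + 1 ≤ n := by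
    have := Nat.ceil_lt_add_one (by linarith : 0 ≤ s)
    rw [ht] at this
    push_cast at this
    linarith
  have ht1 : 1 ≤ t := by
    have : (1 : ℝ) ≤ t := by linarith
    exact_mod_cast this
  calc unifProb (A.on n) (fun G => s ≤ (G.maxBlockDegree : ℝ))
      ≤ unifProb (A.on n) (fun G => t < G.maxBlockDegree) :=
        unifProb_mono fun G _ hG => by
          have := Nat.ceil_le.2 hG
          omega
    _ ≤ n / t.factorial := unifProb_lt_maxBlockDegree_le hA hne (Or.inl le_rfl) ht1
    _ = n * (1 / t.factorial) := by ring
    _ ≤ n * (n * Real.exp (s - s * Real.log s)) := by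
        refine mul_le_mul_of_nonneg_left ((one_div_factorial_le (by linarith) hst).trans ?_)
          (Nat.cast_nonneg n)
        exact mul_le_mul_of_nonneg_right hts (Real.exp_pos _).le
    _ ≤ _ := hexp

end MaxBlockDegree

theorem theorem1 :
    -- for each weakly block-stable class
    (∀ A : GraphClass, A.IsWeaklyBlockStable →
      -- (a)
      (∀ n : ℕ, 2 ≤ n → (A.connectedPart.on n).Nonempty →
        StochLEVec (A.connectedPart.on n) (fun G => G.blockDegreeSeq)
          (treesOn n) (fun T => T.degreeSeq) ∧
        StochLE (A.connectedPart.on n) (fun G => (G.maxBlockDegree : ℝ))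
          (treesOn n) (fun T => T.maxDegreeReal)) ∧
      -- (b), maximum block-degree whp
      Tendsto (fun n : ℕ => unifProb (A.on n)
          (fun G => (G.maxBlockDegree : ℝ) ≤ degreeBound (n : ℝ)))
        A.sizes (𝓝 1) ∧
      -- (b), at most `k n` blocks
      (∀ k : ℕ → ℝ, Tendsto k A.sizes atTop →
        (∀ n : ℕ, 1 ≤ n → ∀ G ∈ A.on n, (G.numBlocks : ℝ) ≤ k n) →
        Tendsto (fun n : ℕ => unifProb (A.on n)
            (fun G => (G.maxBlockDegree : ℝ) ≤ degreeBound (k n)))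
          A.sizes (𝓝 1))) ∧
    -- (b), large deviations: the threshold `N` depends only on `c`
    (∀ c : ℝ, 0 < c → ∃ N : ℕ, ∀ A : GraphClass, A.IsWeaklyBlockStable →
      ∀ n : ℕ, N ≤ n → (A.on n).Nonempty →
        unifProb (A.on n) (fun G => c * (n : ℝ) / Real.log (n : ℝ) ≤ (G.maxBlockDegree : ℝ)) ≤
          Real.exp (-((1 - etaFn (n : ℝ)) * c * (n : ℝ)))) ∧
    -- the error terms tend to zero
    Tendsto epsFn atTop (𝓝 0) ∧ Tendsto etaFn atTop (𝓝 0) := by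
  refine ⟨fun A hA => ⟨fun n hn hne => ?_, ?_, fun k hk hK => ?_⟩,
    exists_forall_unifProb_large_deviation_le, tendsto_epsFn, tendsto_etaFn⟩
  · have h := stochLEVec_blockDegreeSeq hA hn hne
    exact ⟨h, h.stochLE_of_le_iff (le_maxBlockDegree_iff hn) (le_maxDegreeReal_iff hn)⟩
  · exact tendsto_unifProb_maxBlockDegree_le hA
      (tendsto_natCast_atTop_atTop.mono_left inf_le_left) fun n _ => Or.inl le_rfl
  · exact tendsto_unifProb_maxBlockDegree_le hA hk fun n hn => Or.inr (hK n hn)
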